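/- Let $\mathcal R$ be a condensed ring (associative and unital, not necessarily commutative) and let $\mathcal H\le\mathcal G$ be condensed groups, where condensed objects are sheaves on the site of extremally disconnected compact Hausdorff spaces with finite jointly surjective families as covers. Suppose that $\mathcal H$ has finite index in $\mathcal G$, that is: $\mathcal H$ is open in $\mathcal G$ (for every extremally disconnected $S$ and every map $\underline S\to\mathcal G$, the pullback $\underline S\times_{\mathcal G}\mathcal H$ is representable by an open subset of $S$) and the set $(\mathcal G/\mathcal H)(*)=\mathcal G(*)/\mathcal H(*)$ is finite. Let $\mathcal R[\mathcal H]$ and $\mathcal R[\mathcal G]$ be the condensed group rings (the sheafifications of $S\mapsto \mathcal R(S)[\mathcal H(S)]$ and $S\mapsto\mathcal R(S)[\mathcal G(S)]$), and for a condensed right $\mathcal R[\mathcal H]$-module $\mathcal M$ let $$\mathrm{Ind}^{\mathcal G}_{\mathcal H}\mathcal M=\mathcal M\otimes_{\mathcal R[\mathcal H]}\mathcal R[\mathcal G],\qquad \mathrm{Coind}^{\mathcal G}_{\mathcal H}\mathcal M=\underline{\mathrm{Hom}}_{\mathcal R[\mathcal H]}(\mathcal R[\mathcal G],\mathcal M)$$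 be the induced and coinduced condensed right $\mathcal R[\mathcal G]$-modules. Then: 1. For every finite system $r_1,\dots,r_n\in\mathcal G(*)$ of representatives of the right cosets $\mathcal H(*)\backslash\mathcal G(*)$, the condensed ring $\mathcal R[\mathcal G]$ is the finite direct sum $\bigoplus_{k=1}^n\mathcal R[\mathcal H r_k]$ of free left $\mathcal R[\mathcal H]$-submodules of rank one; that is, for every $S$ the map $\mathcal R[\mathcal H](S)^n\to\mathcal R[\mathcal G](S)$, $(x_k)_k\mapsto\sum_k x_k\,[r_k]$, is bijective. 2. The functors $\mathrm{Ind}^{\mathcal G}_{\mathcal H}$ and $\mathrm{Coind}^{\mathcal G}_{\mathcal H}$, from condensed right $\mathcal R[\mathcal H]$-modules to condensed right $\mathcal R[\mathcal G]$-modules, are canonically isomorphic: there is exactly one natural isomorphism $e\colon\mathrm{Ind}^{\mathcal G}_{\mathcal H}\to\mathrm{Coind}^{\mathcal G}_{\mathcal H}$ of functors into $\mathcal R[\mathcal G]$-modules such that, for all $\mathcal M$, all $S$, all $m\in\mathcal M(S)$ and all $g\in\mathcal G(S)$, $$e_{\mathcal M}(m\otimes1)([g])=\begin{cases} m\cdot[g]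 & \text{if } g\in\mathcal H(S),\\ 0 & \text{if } g(s)\notin\mathcal H(*)\text{ for every point } s\in S.\end{cases}$$ -/

import Mathlib

open CategoryTheory Opposite
open scoped TensorProduct

universe u

namespace Cond

noncomputable section

/-! ## Condensed groups, rings and modules -/

/-- The site of extremally disconnected compact Hausdorff spaces, with finite jointly surjective
families as covers. -/
abbrev site : GrothendieckTopology Stonean.{u} := coherentTopology Stonean.{u}

/-- Condensed groups. -/
abbrev CGrp := Sheaf site.{u} GrpCat.{u + 1}

/-- Condensed rings (associative and unital, not necessarily commutative). -/
abbrev CRing := Sheaf site.{u} RingCat.{u + 1}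

/-- The functor taking a ring to its opposite ring. -/
def ringOp : RingCat.{u} ⥤ RingCat.{u} where
  obj A := RingCat.of (A : Type u)ᵐᵒᵖ
  map f := RingCat.ofHom (RingHom.op f.hom)

/-- The opposite condensed ring, `S ↦ A(S)ᵐᵒᵖ`. -/
def CRing.opp (A : CRing.{u}) : CRing.{u} where
  obj := A.obj ⋙ ringOp
  property := by
    have h := (Presheaf.isSheaf_iff_isSheaf_forget _ _ (forget RingCat.{u + 1})).1 A.property
    refine (Presheaf.isSheaf_iff_isSheaf_forget _ _ (forget RingCat.{u + 1})).2 ?_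
    refine (Presheaf.isSheaf_of_iso_iff (NatIso.ofComponents
      (fun S => (MulOpposite.opEquiv (α := A.obj.obj S)).toIso) ?_)).1 h
    intro S T f
    rfl

/-- Condensed right `A`-modules, i.e. sheaves of modules over the opposite ring. -/
abbrev CMod (A : CRing.{u}) := SheafOfModules.{u + 1} A.opp

instance (A : CRing.{u}) (M : PresheafOfModules.{u + 1} A.opp.obj) (S : Stonean.{u}ᵒᵖ) :
    Module (A.obj.obj S : Type (u + 1))ᵐᵒᵖ (M.obj S) :=
  inferInstanceAs (Module (A.opp.obj.obj S) (M.obj S))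

/-- The restriction map `M(S) → M(T)` along `T → S`, as an additive map. -/
def CMod.res {A : CRing.{u}} (M : CMod A) {S T : Stonean.{u}ᵒᵖ} (f : S ⟶ T) :
    M.val.obj S →+ M.val.obj T :=
  (M.val.presheaf.map f).hom

theorem CMod.res_smul {A : CRing.{u}} (M : CMod A) {S T : Stonean.{u}ᵒᵖ} (f : S ⟶ T)
    (a : A.obj.obj S) (m : M.val.obj S) :
    M.res f (MulOpposite.op a • m) = MulOpposite.op ((A.obj.map f).hom a) • M.res f m :=
  PresheafOfModules.map_smul M.val f (MulOpposite.op a) m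

theorem CMod.res_id {A : CRing.{u}} (M : CMod A) (S : Stonean.{u}ᵒᵖ) (m : M.val.obj S) :
    M.res (𝟙 S) m = m :=
  congrArg (fun k => k.hom m) (M.val.presheaf.map_id S)

theorem CMod.res_comp {A : CRing.{u}} (M : CMod A) {S T U : Stonean.{u}ᵒᵖ} (f : S ⟶ T)
    (g : T ⟶ U) (m : M.val.obj S) : M.res (f ≫ g) m = M.res g (M.res f m) :=
  congrArg (fun k => k.hom m) (M.val.presheaf.map_comp f g)

/-- The map `M(S) → N(S)` given by a morphism of condensed modules, as an additive map. -/
def CMod.app {A : CRing.{u}} {M N : CMod A} (q : M ⟶ N) (S : Stonean.{u}ᵒᵖ) :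
    M.val.obj S →+ N.val.obj S :=
  ((q.val.app S).hom : M.val.obj S →ₗ[A.opp.obj.obj S] N.val.obj S).toAddMonoidHom

theorem CMod.app_smul {A : CRing.{u}} {M N : CMod A} (q : M ⟶ N) (S : Stonean.{u}ᵒᵖ)
    (a : A.obj.obj S) (m : M.val.obj S) :
    CMod.app q S (MulOpposite.op a • m) = MulOpposite.op a • CMod.app q S m :=
  (q.val.app S).hom.map_smul (MulOpposite.op a : A.opp.obj.obj S) m

theorem CMod.app_res {A : CRing.{u}} {M N : CMod A} (q : M ⟶ N) {S T : Stonean.{u}ᵒᵖ}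
    (f : S ⟶ T) (m : M.val.obj S) : CMod.app q T (M.res f m) = N.res f (CMod.app q S m) :=
  PresheafOfModules.naturality_apply q.val f m

/-! ## Tensor products over noncommutative rings -/

section Tensor

variable {A B : Type*} [Ring A] [Ring B] (φ : A →+* B)
variable (M : Type*) [AddCommGroup M] [Module Aᵐᵒᵖ M]

/-- The relations `m ⊗ φ(a) b = m a ⊗ b` (with the two factors written in the reverse order, so
that the right multiplication of `B` on itself acts on the first factor). -/
def tensorRel : Submodule Bᵐᵒᵖ (B ⊗[ℤ] M) :=
  Submodule.span Bᵐᵒᵖ {t | ∃ (a : A) (b : B) (m : M),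
    t = (φ a * b) ⊗ₜ[ℤ] m - b ⊗ₜ[ℤ] (MulOpposite.op a • m)}

/-- The right `B`-module `M ⊗_A B`, for a right `A`-module `M` and a ring homomorphism
`φ : A → B`; here `B` is a left `A`-module through `φ`. The spanning set of `tensorRel` is stable
under `B`, so this is the quotient of `M ⊗_ℤ B` by the subgroup it generates. -/
abbrev TensorAlong : Type _ := (B ⊗[ℤ] M) ⧸ tensorRel φ M

variable {M}

/-- The element `m ⊗ b` of `M ⊗_A B`. -/
def TensorAlong.tmul (m : M) (b : B) : TensorAlong φ M :=
  (tensorRel φ M).mkQ (b ⊗ₜ[ℤ] m)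

variable {φ}

theorem TensorAlong.tmul_smul (m : M) (b c : B) :
    MulOpposite.op c • TensorAlong.tmul φ m b = TensorAlong.tmul φ m (b * c) := rfl

theorem TensorAlong.tmul_mul (m : M) (a : A) (b : B) :
    TensorAlong.tmul φ m (φ a * b) = TensorAlong.tmul φ (MulOpposite.op a • m) b := by
  refine (Submodule.Quotient.eq _).2 (Submodule.subset_span ⟨a, b, m, rfl⟩)

theorem TensorAlong.induction {p : TensorAlong φ M → Prop} (x : TensorAlong φ M)
    (zero : p 0) (tmul : ∀ m b, p (TensorAlong.tmul φ m b))
    (add : ∀ x y, p x → p y → p (x + y)) : p x := by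
  obtain ⟨t, rfl⟩ := (tensorRel φ M).mkQ_surjective x
  induction t with
  | zero => simpa using zero
  | tmul b m => exact tmul m b
  | add s t hs ht => simpa using add _ _ hs ht

variable {A' B' M' : Type*} [Ring A'] [Ring B'] {φ' : A' →+* B'}
variable [AddCommGroup M'] [Module A'ᵐᵒᵖ M']

/-- Functoriality of `M ⊗_A B` in all three arguments, `m ⊗ b ↦ μ(m) ⊗ β(b)`. -/
def TensorAlong.map (α : A →+* A') (β : B →+* B') (hφ : ∀ a, β (φ a) = φ' (α a)) (μ : M →+ M')
    (hμ : ∀ (a : A) (m : M), μ (MulOpposite.op a • m) = MulOpposite.op (α a) • μ m) :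
    TensorAlong φ M →ₛₗ[RingHom.op β] TensorAlong φ' M' :=
  Submodule.mapQ _ _
    { toFun := TensorProduct.map β.toAddMonoidHom.toIntLinearMap μ.toIntLinearMap
      map_add' := map_add _
      map_smul' := by
        intro c t
        induction t with
        | zero => simp
        | add s t hs ht => rw [smul_add, map_add, hs, ht, map_add, smul_add]
        | tmul b m =>
          rw [TensorProduct.smul_tmul']
          simp [TensorProduct.smul_tmul'] } <| by
    refine Submodule.span_le.2 ?_
    rintro _ ⟨a, b, m, rfl⟩
    refine Submodule.subset_span ⟨α a, β b, μ m, ?_⟩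
    simp [hφ, hμ]

theorem TensorAlong.map_tmul (α : A →+* A') (β : B →+* B') (hφ : ∀ a, β (φ a) = φ' (α a))
    (μ : M →+ M') (hμ : ∀ (a : A) (m : M), μ (MulOpposite.op a • m) = MulOpposite.op (α a) • μ m)
    (m : M) (b : B) :
    TensorAlong.map α β hφ μ hμ (TensorAlong.tmul φ m b) = TensorAlong.tmul φ' (μ m) (β b) := rfl

end Tensor

/-! ## Extension of scalars `M ⊗_A B` for condensed modules -/

section Extend

variable {A B : CRing.{u}} (φ : A ⟶ B)

theorem hom_naturality {S T : Stonean.{u}ᵒᵖ} (f : S ⟶ T) (a : A.obj.obj S) :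
    (B.obj.map f).hom ((φ.hom.app S).hom a) = (φ.hom.app T).hom ((A.obj.map f).hom a) :=
  congrArg (fun k => k.hom a) (φ.hom.naturality f).symm

/-- The restriction map of the presheaf `S ↦ M(S) ⊗_{A(S)} B(S)`. -/
def tensorRes (M : CMod A) {S T : Stonean.{u}ᵒᵖ} (f : S ⟶ T) :
    TensorAlong (φ.hom.app S).hom (M.val.obj S) →ₛₗ[RingHom.op (B.obj.map f).hom]
      TensorAlong (φ.hom.app T).hom (M.val.obj T) :=
  TensorAlong.map (A.obj.map f).hom (B.obj.map f).hom (hom_naturality φ f) (M.res f) (M.res_smul f)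

/-- The presheaf of abelian groups `S ↦ M(S) ⊗_{A(S)} B(S)`. -/
def tensorAb (M : CMod A) : Stonean.{u}ᵒᵖ ⥤ AddCommGrpCat.{u + 1} where
  obj S := AddCommGrpCat.of (TensorAlong (φ.hom.app S).hom (M.val.obj S))
  map f := AddCommGrpCat.ofHom (tensorRes φ M f).toAddMonoidHom
  map_id S := by
    ext x
    change tensorRes φ M (𝟙 S) x = x
    induction x using TensorAlong.induction with
    | zero => exact map_zero _
    | add x y hx hy => rw [map_add, hx, hy]
    | tmul m b =>
      rw [tensorRes, TensorAlong.map_tmul, M.res_id]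
      simp
  map_comp {S T U} f g := by
    ext x
    change tensorRes φ M (f ≫ g) x = tensorRes φ M g (tensorRes φ M f x)
    induction x using TensorAlong.induction with
    | zero => simp only [map_zero]
    | add x y hx hy => rw [map_add, hx, hy, map_add, map_add]
    | tmul m b =>
      simp only [tensorRes, TensorAlong.map_tmul, M.res_comp]
      simp

instance (M : CMod A) (S : Stonean.{u}ᵒᵖ) : Module (B.opp.obj.obj S) ((tensorAb φ M).obj S) :=
  inferInstanceAs (Module (B.obj.obj S : Type (u + 1))ᵐᵒᵖ
    (TensorAlong (φ.hom.app S).hom (M.val.obj S)))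

/-- The presheaf of right `B`-modules `S ↦ M(S) ⊗_{A(S)} B(S)`. -/
def tensorPresheaf (M : CMod A) : PresheafOfModules.{u + 1} B.opp.obj :=
  PresheafOfModules.ofPresheaf (tensorAb φ M) fun _ _ f b x =>
    (tensorRes φ M f).map_smulₛₗ b x

/-- The map `M(S) ⊗_{A(S)} B(S) → N(S) ⊗_{A(S)} B(S)` induced by `q : M → N`. -/
def tensorApp {M N : CMod A} (q : M ⟶ N) (S : Stonean.{u}ᵒᵖ) :
    TensorAlong (φ.hom.app S).hom (M.val.obj S) →ₛₗ[RingHom.op (RingHom.id (B.obj.obj S))]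
      TensorAlong (φ.hom.app S).hom (N.val.obj S) :=
  TensorAlong.map (RingHom.id (A.obj.obj S)) (RingHom.id (B.obj.obj S)) (fun _ => rfl)
    (CMod.app q S) (CMod.app_smul q S)

/-- Functoriality of `S ↦ M(S) ⊗_{A(S)} B(S)` in `M`. -/
def tensorPresheafMap {M N : CMod A} (q : M ⟶ N) : tensorPresheaf φ M ⟶ tensorPresheaf φ N :=
  PresheafOfModules.homMk
    { app := fun S => AddCommGrpCat.ofHom (tensorApp φ q S).toAddMonoidHom
      naturality := fun S T f => by
        ext x
        change tensorApp φ q T (tensorRes φ M f x) = tensorRes φ N f (tensorApp φ q S x)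
        induction x using TensorAlong.induction with
        | zero => simp only [map_zero]
        | add x y hx hy => simp only [map_add, hx, hy]
        | tmul m b => simp [tensorRes, tensorApp, TensorAlong.map_tmul, CMod.app_res] }
    fun S b x => (tensorApp φ q S).map_smulₛₗ b x

/-- The functor `M ↦ M ⊗_A B` from condensed right `A`-modules to condensed right `B`-modules:
the sheafification of the pointwise tensor product. -/
def extend : CMod A ⥤ CMod B where
  obj M := (PresheafOfModules.sheafification (𝟙 B.opp.obj)).obj (tensorPresheaf φ M)
  map q := (PresheafOfModules.sheafification (𝟙 B.opp.obj)).map (tensorPresheafMap φ q)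
  map_id M := by
    rw [← CategoryTheory.Functor.map_id]
    congr 1
    ext S x
    change tensorApp φ (𝟙 M) S x = x
    induction x using TensorAlong.induction with
    | zero => exact map_zero _
    | add x y hx hy => rw [map_add, hx, hy]
    | tmul m b => rfl
  map_comp {M N P} q r := by
    rw [← CategoryTheory.Functor.map_comp]
    congr 1
    ext S x
    change tensorApp φ (q ≫ r) S x = tensorApp φ r S (tensorApp φ q S x)
    induction x using TensorAlong.induction with
    | zero => simp only [map_zero]
    | add x y hx hy => simp only [map_add, hx, hy]
    | tmul m b => rfl

/-- The section `m ⊗ b` of `M ⊗_A B` over `S`. -/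
def extend.tmul {M : CMod A} {S : Stonean.{u}} (m : M.val.obj (op S)) (b : B.obj.obj (op S)) :
    ((extend φ).obj M).val.obj (op S) :=
  ((toSheafify site (tensorPresheaf φ M).presheaf).app (op S)).hom
    (TensorAlong.tmul (φ.hom.app (op S)).hom m b)

end Extend

/-! ## Coextension of scalars `Hom_A(B, M)` for condensed modules -/

section Coextend

variable {A B : CRing.{u}} (φ : A ⟶ B)

/-- Sections over `S` of the internal Hom `Hom_A(B, M)`: the compatible families of right
`A(T)`-linear maps `B(T) → M(T)`, one for each `T → S`. Such a family is the same as a morphism of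
right `A`-modules `ℤ[S] ⊗ B → M`, whose value at `[f] ⊗ b` is the value of the family at
`f : T → S` and `b`. -/
def coextendSections (M : CMod A) (S : Stonean.{u}) :
    AddSubgroup (∀ (T : Stonean.{u}) (_ : T ⟶ S), B.obj.obj (op T) →+ M.val.obj (op T)) where
  carrier := {c |
    (∀ (T : Stonean.{u}) (f : T ⟶ S) (b : B.obj.obj (op T)) (a : A.obj.obj (op T)),
      c T f (b * (φ.hom.app (op T)).hom a) = MulOpposite.op a • c T f b) ∧
    (∀ (T U : Stonean.{u}) (f : T ⟶ S) (g : U ⟶ T) (b : B.obj.obj (op T)),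
      c U (g ≫ f) ((B.obj.map g.op).hom b) = M.res g.op (c T f b))}
  zero_mem' := ⟨by simp, by simp⟩
  add_mem' := by
    rintro c d ⟨hc, hc'⟩ ⟨hd, hd'⟩
    exact ⟨by simp [hc, hd], by simp [hc', hd']⟩
  neg_mem' := by
    rintro c ⟨hc, hc'⟩
    exact ⟨by simp [hc], by simp [hc']⟩

/-- The right action of `B(S)` on the sections of `Hom_A(B, M)` over `S`: `(c b)(x) = c(b x)`. -/
instance (M : CMod A) (S : Stonean.{u}) :
    Module (B.obj.obj (op S) : Type (u + 1))ᵐᵒᵖ (coextendSections φ M S) where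
  smul b c := ⟨fun T f => (c.1 T f).comp
      (AddMonoidHom.mulLeft ((B.obj.map f.op).hom b.unop)), by
    refine ⟨fun T f x a => ?_, fun T U f g x => ?_⟩
    · simp [← mul_assoc, c.2.1]
    · have h := c.2.2 T U f g ((B.obj.map f.op).hom b.unop * x)
      simpa using h⟩
  one_smul c := by
    ext T f x
    change c.1 T f ((B.obj.map f.op).hom 1 * x) = c.1 T f x
    simp
  mul_smul b b' c := by
    ext T f x
    change c.1 T f ((B.obj.map f.op).hom (b'.unop * b.unop) * x) =
      c.1 T f ((B.obj.map f.op).hom b'.unop * ((B.obj.map f.op).hom b.unop * x))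
    simp [mul_assoc]
  smul_zero b := rfl
  smul_add b c d := rfl
  add_smul b b' c := by
    ext T f x
    change c.1 T f ((B.obj.map f.op).hom (b.unop + b'.unop) * x) =
      c.1 T f ((B.obj.map f.op).hom b.unop * x) + c.1 T f ((B.obj.map f.op).hom b'.unop * x)
    simp [add_mul]
  zero_smul c := by
    ext T f x
    change c.1 T f ((B.obj.map f.op).hom 0 * x) = 0
    simp

theorem coextendSections.smul_apply {M : CMod A} {S : Stonean.{u}}
    (b : (B.obj.obj (op S) : Type (u + 1))) (c : coextendSections φ M S) (T : Stonean.{u})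
    (f : T ⟶ S) (x : B.obj.obj (op T)) :
    (MulOpposite.op b • c).1 T f x = c.1 T f ((B.obj.map f.op).hom b * x) := rfl

/-- Restriction of sections of `Hom_A(B, M)` along `g : S' → S`. -/
def coextendSections.res {M : CMod A} {S S' : Stonean.{u}} (g : S' ⟶ S) :
    coextendSections φ M S →+ coextendSections φ M S' where
  toFun c := ⟨fun T f => c.1 T (f ≫ g), fun T f => c.2.1 T (f ≫ g), fun T U f h b => by
    have := c.2.2 T U (f ≫ g) h b
    rwa [← Category.assoc] at this⟩
  map_zero' := rfl
  map_add' _ _ := rfl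

/-- The presheaf of abelian groups underlying `Hom_A(B, M)`. -/
def coextendAb (M : CMod A) : Stonean.{u}ᵒᵖ ⥤ AddCommGrpCat.{u + 1} where
  obj S := AddCommGrpCat.of (coextendSections φ M S.unop)
  map g := AddCommGrpCat.ofHom (coextendSections.res φ g.unop)
  map_id S := by
    refine AddCommGrpCat.hom_ext (AddMonoidHom.ext fun c => ?_)
    refine Subtype.ext (funext fun T => funext fun f => ?_)
    change c.1 T (f ≫ 𝟙 _) = c.1 T f
    rw [Category.comp_id]
  map_comp {S T U} f g := by
    refine AddCommGrpCat.hom_ext (AddMonoidHom.ext fun c => ?_)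
    refine Subtype.ext (funext fun V => funext fun h => ?_)
    change c.1 V (h ≫ g.unop ≫ f.unop) = c.1 V ((h ≫ g.unop) ≫ f.unop)
    rw [Category.assoc]

instance (M : CMod A) (S : Stonean.{u}ᵒᵖ) : Module (B.opp.obj.obj S) ((coextendAb φ M).obj S) :=
  inferInstanceAs (Module (B.obj.obj (op S.unop) : Type (u + 1))ᵐᵒᵖ (coextendSections φ M S.unop))

/-- The presheaf of right `B`-modules underlying `Hom_A(B, M)`. -/
def coextendPresheaf (M : CMod A) : PresheafOfModules.{u + 1} B.opp.obj :=
  PresheafOfModules.ofPresheaf (coextendAb φ M) fun S S' g b c => by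
    refine Subtype.ext (funext fun T => funext fun f => AddMonoidHom.ext fun x => ?_)
    change c.1 T (f ≫ g.unop) ((B.obj.map (f ≫ g.unop).op).hom (MulOpposite.unop b) * x) =
      c.1 T (f ≫ g.unop) ((B.obj.map f.op).hom ((B.obj.map g).hom (MulOpposite.unop b)) * x)
    simp

theorem coextend_isSheaf (M : CMod A) : Presheaf.IsSheaf site (coextendPresheaf φ M).presheaf := by
  change Presheaf.IsSheaf site (coextendAb φ M)
  have hM := (isSheaf_iff_isSheaf_of_type _ _).1
    ((Presheaf.isSheaf_iff_isSheaf_forget _ _ (forget AddCommGrpCat.{u + 1})).1 M.isSheaf)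
  refine (Presheaf.isSheaf_iff_isSheaf_forget _ _ (forget AddCommGrpCat.{u + 1})).2 ?_
  refine (isSheaf_iff_isSheaf_of_type _ _).2 fun S R hR => ?_
  -- two sections of `M` agree if they do so on a covering sieve
  have sep : ∀ {T : Stonean.{u}} (f : T ⟶ S) (m m' : M.val.obj (op T)),
      (∀ (U : Stonean.{u}) (p : U ⟶ T), R (p ≫ f) → M.res p.op m = M.res p.op m') → m = m' :=
    fun {T} f m m' h => (hM (R.pullback f) (site.pullback_stable f hR)).isSeparatedFor.ext
      fun U p hp => h U p hp
  intro x hx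
  -- the family `x`, as a family of compatible families of maps
  let y : ∀ {T : Stonean.{u}} (f : T ⟶ S), R f → coextendSections φ M T := fun f hf => x f hf
  have hy : ∀ {T U : Stonean.{u}} (f : T ⟶ S) (hf : R f) (g : U ⟶ T) (hg : R (g ≫ f)),
      y (g ≫ f) hg = coextendSections.res φ g (y f hf) := fun {T U} f hf g hg => by
    have := hx (𝟙 U) g hg hf (by simp)
    refine Eq.trans ?_ this
    refine Subtype.ext (funext fun V => funext fun h => ?_)
    change _ = (x (g ≫ f) hg : coextendSections φ M U).1 V (h ≫ 𝟙 _)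
    rw [Category.comp_id]
  have yres : ∀ {T U V : Stonean.{u}} (f : T ⟶ S) (hf : R f) (g : U ⟶ T) (hg : R (g ≫ f))
      (h : V ⟶ U), (y (g ≫ f) hg).1 V h = (y f hf).1 V (h ≫ g) := fun f hf g hg h => by
    rw [hy f hf g hg]; rfl
  -- local description of the glued family
  have glue : ∀ (T : Stonean.{u}) (f : T ⟶ S) (b : B.obj.obj (op T)),
      ∃ m : M.val.obj (op T), ∀ (U : Stonean.{u}) (p : U ⟶ T) (hp : R (p ≫ f)),
        M.res p.op m = (y (p ≫ f) hp).1 U (𝟙 U) ((B.obj.map p.op).hom b) := by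
    intro T f b
    obtain ⟨m, hm, -⟩ := hM (R.pullback f) (site.pullback_stable f hR)
      (fun U p hp => (y (p ≫ f) hp).1 U (𝟙 U) ((B.obj.map p.op).hom b)) (by
        intro U₁ U₂ V g₁ g₂ f₁ f₂ h₁ h₂ e
        change M.res g₁.op ((y (f₁ ≫ f) h₁).1 U₁ (𝟙 U₁) ((B.obj.map f₁.op).hom b)) =
          M.res g₂.op ((y (f₂ ≫ f) h₂).1 U₂ (𝟙 U₂) ((B.obj.map f₂.op).hom b))
        have key : ∀ {U : Stonean.{u}} (g : V ⟶ U) (k : U ⟶ T) (hk : R (k ≫ f))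
            (hgk : R ((g ≫ k) ≫ f)),
            M.res g.op ((y (k ≫ f) hk).1 U (𝟙 U) ((B.obj.map k.op).hom b)) =
              (y ((g ≫ k) ≫ f) hgk).1 V (𝟙 V) ((B.obj.map (g ≫ k).op).hom b) := by
          intro U g k hk hgk
          rw [← (y (k ≫ f) hk).2.2]
          have e1 : y ((g ≫ k) ≫ f) hgk = coextendSections.res φ g (y (k ≫ f) hk) := by
            rw [← hy (k ≫ f) hk g (by simpa using hgk)]
            congr 1
          rw [e1]
          change (y (k ≫ f) hk).1 V (g ≫ 𝟙 U) _ = (y (k ≫ f) hk).1 V (𝟙 V ≫ g) _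
          simp
        have h3 : R ((g₁ ≫ f₁) ≫ f) := by
          rw [Category.assoc]; exact R.downward_closed h₁ g₁
        have cast : ∀ (k k' : V ⟶ T) (hk : R (k ≫ f)) (hk' : R (k' ≫ f)), k = k' →
            (y (k ≫ f) hk).1 V (𝟙 V) ((B.obj.map k.op).hom b) =
              (y (k' ≫ f) hk').1 V (𝟙 V) ((B.obj.map k'.op).hom b) := by
          rintro k _ hk hk' rfl
          rfl
        rw [key g₁ f₁ h₁ h3, key g₂ f₂ h₂ (e ▸ h3)]
        exact cast _ _ _ _ e)
    exact ⟨m, fun U p hp => hm p hp⟩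
  choose c hc using glue
  let d : coextendSections φ M S := ⟨fun T f =>
    { toFun := c T f
      map_zero' := sep f _ _ fun U p hp => by rw [hc _ _ _ _ _ hp]; simp
      map_add' := fun b b' => sep f _ _ fun U p hp => by
        rw [map_add, hc _ _ _ _ _ hp, hc _ _ _ _ _ hp, hc _ _ _ _ _ hp]; simp }, by
    refine ⟨fun T f b a => sep f _ _ fun U p hp => ?_, fun T U f g b =>
      sep (g ≫ f) _ _ fun V p hp => ?_⟩
    · change M.res p.op (c T f _) = M.res p.op (_ • c T f b)
      rw [hc _ _ _ _ _ hp, M.res_smul, hc _ _ _ _ _ hp, ← (y (p ≫ f) hp).2.1, map_mul,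
        hom_naturality]
    · change M.res p.op (c U (g ≫ f) _) = M.res p.op (M.res g.op (c T f b))
      have hp' : R ((p ≫ g) ≫ f) := by rwa [Category.assoc]
      rw [hc _ _ _ _ _ hp, ← M.res_comp, ← op_comp, hc _ _ _ _ _ hp']
      have : y (p ≫ g ≫ f) hp = y ((p ≫ g) ≫ f) hp' := by
        congr 1
      rw [this]
      simp⟩
  refine ⟨d, fun T f hf => ?_, fun d' hd' => ?_⟩
  · change coextendSections.res φ f d = y f hf
    refine Subtype.ext (funext fun U => funext fun g => AddMonoidHom.ext fun b => ?_)
    change c U (g ≫ f) b = (y f hf).1 U g b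
    refine sep (g ≫ f) _ _ fun V p hp => ?_
    rw [hc _ _ _ _ _ hp, ← (y f hf).2.2]
    have hp' : R ((p ≫ g) ≫ f) := by rwa [Category.assoc]
    have : y (p ≫ g ≫ f) hp = y ((p ≫ g) ≫ f) hp' := by
      congr 1
    rw [this, yres f hf]
    simp
  · refine Subtype.ext (funext fun T => funext fun f => AddMonoidHom.ext fun b => ?_)
    change (d' : coextendSections φ M S).1 T f b = c T f b
    refine sep f _ _ fun U p hp => ?_
    rw [hc _ _ _ _ _ hp, ← (d' : coextendSections φ M S).2.2]
    have : coextendSections.res φ (p ≫ f) d' = y (p ≫ f) hp := hd' (p ≫ f) hp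
    rw [← this]
    change _ = (d' : coextendSections φ M S).1 U (𝟙 U ≫ p ≫ f) _
    rw [Category.id_comp]

/-- The map `Hom_A(B, M)(S) → Hom_A(B, N)(S)` induced by `q : M → N`. -/
def coextendApp {M N : CMod A} (q : M ⟶ N) (S : Stonean.{u}) :
    coextendSections φ M S →+ coextendSections φ N S where
  toFun c := ⟨fun T f => (CMod.app q (op T)).comp (c.1 T f),
    fun T f b a => by simp [c.2.1, CMod.app_smul],
    fun T U f g b => by simp [c.2.2, CMod.app_res]⟩
  map_zero' := Subtype.ext (funext fun T => funext fun f => AddMonoidHom.ext fun b => by simp)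
  map_add' c d := Subtype.ext (funext fun T => funext fun f => AddMonoidHom.ext fun b => by simp)

/-- The functor `M ↦ Hom_A(B, M)` from condensed right `A`-modules to condensed right
`B`-modules. -/
def coextend : CMod A ⥤ CMod B where
  obj M := ⟨coextendPresheaf φ M, coextend_isSheaf φ M⟩
  map q := ⟨PresheafOfModules.homMk
    { app := fun S => AddCommGrpCat.ofHom (coextendApp φ q S.unop)
      naturality := fun _ _ _ => rfl }
    fun _ _ _ => rfl⟩
  map_id _ := rfl
  map_comp _ _ := rfl

/-- The value in `M(S)` of a section `c` of `Hom_A(B, M)` over `S` at an element `b` of `B(S)`. -/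
def coextend.eval {M : CMod A} {S : Stonean.{u}} (c : ((coextend φ).obj M).val.obj (op S))
    (b : B.obj.obj (op S)) : M.val.obj (op S) :=
  (c : coextendSections φ M S).1 S (𝟙 S) b

end Coextend

/-! ## Condensed group rings, induction and coinduction -/

section GroupRing

/-- The presheaf of group rings `S ↦ R(S)[G(S)]`. -/
def groupRingPresheaf (R : CRing.{u}) (G : CGrp.{u}) : Stonean.{u}ᵒᵖ ⥤ RingCat.{u + 1} where
  obj S := RingCat.of (MonoidAlgebra (R.obj.obj S) (G.obj.obj S))
  map {S T} f := RingCat.ofHom ((MonoidAlgebra.mapDomainRingHom _ (G.obj.map f).hom).comp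
    (MonoidAlgebra.mapRingHom _ (R.obj.map f).hom))
  map_id S := by
    ext x <;> simp
  map_comp f g := by
    ext x <;> simp

/-- The condensed group ring `R[G]`: the sheafification of `S ↦ R(S)[G(S)]`. -/
def groupRing (R : CRing.{u}) (G : CGrp.{u}) : CRing.{u} :=
  (presheafToSheaf site RingCat.{u + 1}).obj (groupRingPresheaf R G)

variable (R : CRing.{u}) {G H : CGrp.{u}}

/-- The section `[g]` of `R[G]` over `S` defined by `g ∈ G(S)`. -/
def groupRing.of {S : Stonean.{u}} (g : G.obj.obj (op S)) : (groupRing R G).obj.obj (op S) :=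
  ((toSheafify site (groupRingPresheaf R G)).app (op S)).hom (MonoidAlgebra.single g 1)

/-- The homomorphism `R[H] → R[G]` induced by a homomorphism `i : H → G`. -/
def groupRingMap (i : H ⟶ G) : groupRing R H ⟶ groupRing R G :=
  (presheafToSheaf site RingCat.{u + 1}).map
    { app := fun S => RingCat.ofHom (MonoidAlgebra.mapDomainRingHom _ (i.hom.app S).hom)
      naturality := fun S T f => by
        have h (x : H.obj.obj S) : (i.hom.app T).hom ((H.obj.map f).hom x) =
            (G.obj.map f).hom ((i.hom.app S).hom x) :=
          congrArg (fun k => k.hom x) (i.hom.naturality f)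
        have h' (x : MonoidAlgebra (R.obj.obj S) (H.obj.obj S)) :
            MonoidAlgebra.mapDomainRingHom (R.obj.obj T) (i.hom.app T).hom
              (MonoidAlgebra.mapDomainRingHom (R.obj.obj T) (H.obj.map f).hom
                (MonoidAlgebra.mapRingHom _ (R.obj.map f).hom x)) =
            MonoidAlgebra.mapDomainRingHom (R.obj.obj T) (G.obj.map f).hom
              (MonoidAlgebra.mapRingHom _ (R.obj.map f).hom
                (MonoidAlgebra.mapDomainRingHom (R.obj.obj S) (i.hom.app S).hom x)) := by
          induction x using MonoidAlgebra.induction_linear with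
          | zero => simp only [map_zero]
          | add x y hx hy => simp only [map_add, hx, hy]
          | single x r => simp [h]
        exact RingCat.hom_ext (RingHom.ext h') }

/-- The induction functor `M ↦ M ⊗_{R[H]} R[G]`. -/
def ind (i : H ⟶ G) : CMod (groupRing R H) ⥤ CMod (groupRing R G) :=
  extend (groupRingMap R i)

/-- The coinduction functor `M ↦ Hom_{R[H]}(R[G], M)`. -/
def coind (i : H ⟶ G) : CMod (groupRing R H) ⥤ CMod (groupRing R G) :=
  coextend (groupRingMap R i)

end GroupRing

/-! ## Subgroups of finite index -/

section FiniteIndex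

variable {G H : CGrp.{u}} (i : H ⟶ G)

/-- The one-point space. -/
abbrev pt : Stonean.{u} := Stonean.of PUnit.{u + 1}

/-- The subgroup `H(S)` of `G(S)`. -/
abbrev subgroupAt (S : Stonean.{u}) : Subgroup (G.obj.obj (op S)) := (i.hom.app (op S)).hom.range

/-- `i : H → G` exhibits `H` as a condensed subgroup of `G`. -/
def IsSubgroup : Prop := ∀ S : Stonean.{u}, Function.Injective (i.hom.app (op S)).hom

/-- The condensed subgroup `H` is open in `G`: for every extremally disconnected `S` and every map
`S → G` (that is, every `g ∈ G(S)`), the pullback of `H` along it is an open subset `U` of `S`,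
i.e. the maps `f : T → S` for which the restriction of `g` to `T` lies in `H` are those with image
in `U`. -/
def IsOpenSubgroup : Prop :=
  ∀ (S : Stonean.{u}) (g : G.obj.obj (op S)), ∃ U : Set S, IsOpen U ∧
    ∀ (T : Stonean.{u}) (f : T ⟶ S), (G.obj.map f.op).hom g ∈ subgroupAt i T ↔ ∀ t : T, f t ∈ U

/-- The condensed subgroup `H` has finite index in `G`: it is open, and the underlying set of the
pointwise quotient `G/H` is finite. -/
def HasFiniteIndex : Prop := IsOpenSubgroup i ∧ Finite (G.obj.obj (op pt.{u}) ⧸ subgroupAt i pt.{u})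

/-- The value over `S` of the element `γ` of the underlying group of `G`. -/
def constSection {G : CGrp.{u}} (S : Stonean.{u}) (γ : G.obj.obj (op pt.{u})) : G.obj.obj (op S) :=
  (G.obj.map (Quiver.Hom.op (ConcreteCategory.ofHom ⟨fun _ => PUnit.unit, continuous_const⟩ :
    S ⟶ pt.{u}))).hom γ

end FiniteIndex

end

end Cond

namespace Cond

noncomputable section

/-! The argument is that `R[H] → R[G]` is a Frobenius extension, as for abstract groups; openness
makes the usual case distinctions work over a general `S`.

For a section `g` of `G` over `S`, the locus where `g` lies in `H` is open, and its complement is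
open because translates of `H` by points of `G` are open too. Hence `S` is a disjoint union of two
clopen pieces, over one of which `g` is a section of `H`, while over the other it meets `H` nowhere
(`decompSieve_mem`). Sending `[g]` to `[g]` in the first case and to `0` in the second therefore
glues to a map `π : R[G] → R[H]` (`groupRingProj`). It is a homomorphism of `R[H]`-bimodules, since
multiplying `g` by a section of `H` on either side preserves both cases.

Let `r_k` represent the right cosets of `H(*)` in `G(*)`. Locally on `S`, exactly one `g r_k⁻¹` lies
in `H` and the others meet it nowhere. This gives `b = ∑ π(b [r_k⁻¹]) [r_k]` and, applied to
inverses, `b = ∑ [r_k⁻¹] π([r_k] b)`. The first identity together with `π([r_l] [r_k⁻¹]) = δ_{lk}`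
is the decomposition of `R[G]` into free submodules.

The two identities say that `[r_k⁻¹]` and `[r_k]` are dual bases for `π`. Thus `m ⊗ b ↦ (x ↦ m π(b
x))` has the inverse `c ↦ ∑ c([r_k⁻¹]) ⊗ [r_k]` (`bijective_tensorToCoextend`). This holds before
sheafification, so the presheaf tensor product is already a sheaf. The map involves only `π`, so it
does not depend on the representatives.

For uniqueness, a morphism out of the induced module is determined on the sections `m ⊗ 1`. By
linearity and locality, its values there are determined by their evaluations at those `[g]` for
which `g` lies in `H` or meets it nowhere (`groupRing.hom_ext_of`). -/

theorem mem_site_of_jointly_surjective {S : Stonean.{u}} {R : Sieve S} {α : Type} [Finite α]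
    (X : α → Stonean.{u}) (π : ∀ a, X a ⟶ S) (surj : ∀ s : S, ∃ (a : α) (x : X a), π a x = s)
    (h : ∀ a, R (π a)) : R ∈ site.{u} S :=
  coherentTopology.mem_sieves_of_hasEffectiveEpiFamily R
    ⟨α, inferInstance, X, π, Stonean.effectiveEpiFamily_of_jointly_surjective X π surj, h⟩

/-- The point of `S` given by `s`. -/
def ptTo {S : Stonean.{u}} (s : S) : pt.{u} ⟶ S :=
  ConcreteCategory.ofHom ⟨fun _ => s, continuous_const⟩

/-- The inclusion of a clopen subset. -/
theorem exists_clopen_incl {S : Stonean.{u}} {U : Set S} (hU : IsClopen U) :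
    ∃ (T : Stonean.{u}) (f : T ⟶ S), Set.range f = U := by
  have : CompactSpace U := isCompact_iff_compactSpace.1 hU.1.isCompact
  have : ExtremallyDisconnected U := ⟨fun V hV => by
    rw [← (closure V).preimage_image_eq Subtype.coe_injective,
      ← hU.1.isClosedEmbedding_subtypeVal.closure_image_eq V]
    exact isOpen_induced (ExtremallyDisconnected.open_closure _
      (hU.2.isOpenEmbedding_subtypeVal.isOpenMap V hV))⟩
  exact ⟨Stonean.of U, ConcreteCategory.ofHom ⟨Subtype.val, continuous_subtype_val⟩,
    Subtype.range_coe⟩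

/-! ### Locality of sections -/

section Sheaf

variable (A : CRing.{u})

theorem CRing.isSheaf_forget : Presieve.IsSheaf site.{u} (A.obj ⋙ forget RingCat.{u + 1}) :=
  (isSheaf_iff_isSheaf_of_type _ _).1
    ((Presheaf.isSheaf_iff_isSheaf_forget _ _ (forget RingCat.{u + 1})).1 A.property)

variable {A}

theorem CRing.ext_of_cover {S : Stonean.{u}} {P : Sieve S} (hP : P ∈ site.{u} S)
    {x y : A.obj.obj (op S)} (h : ∀ (T : Stonean.{u}) (f : T ⟶ S), P f →
      (A.obj.map f.op).hom x = (A.obj.map f.op).hom y) : x = y :=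
  (A.isSheaf_forget P hP).isSeparatedFor.ext fun T f hf => h T f hf

theorem CMod.ext_of_cover {M : CMod A} {S : Stonean.{u}} {P : Sieve S} (hP : P ∈ site.{u} S)
    {x y : M.val.obj (op S)} (h : ∀ (T : Stonean.{u}) (f : T ⟶ S), P f →
      M.res f.op x = M.res f.op y) : x = y :=
  have hM := (isSheaf_iff_isSheaf_of_type _ _).1
    ((Presheaf.isSheaf_iff_isSheaf_forget _ _ (forget AddCommGrpCat.{u + 1})).1 M.isSheaf)
  (hM P hP).isSeparatedFor.ext fun T f hf => h T f hf

/-- The empty family is jointly surjective onto the empty space. Consequently sections over it are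
unique, which settles the degenerate case in which a section of `H` also meets `H` nowhere. -/
theorem bot_mem_site {S : Stonean.{u}} [IsEmpty S] (P : Sieve S) : P ∈ site.{u} S :=
  mem_site_of_jointly_surjective (α := Empty) (fun a => a.elim) (fun a => a.elim)
    (fun s => isEmptyElim s) (fun a => a.elim)

theorem CRing.eq_of_isEmpty {S : Stonean.{u}} [IsEmpty S] (x y : A.obj.obj (op S)) : x = y :=
  CRing.ext_of_cover (bot_mem_site ⊥) fun _ _ h => h.elim

end Sheaf

/-! ### Splitting a space by membership in an open subgroup -/

section Decomp

variable {G H : CGrp.{u}} (i : H ⟶ G)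

/-- The section `g` of `G` meets `H` in no point of `S`. -/
def NowhereIn {S : Stonean.{u}} (g : G.obj.obj (op S)) : Prop :=
  ∀ s : pt.{u} ⟶ S, (G.obj.map s.op).hom g ∉ subgroupAt i pt.{u}

theorem map_comp_hom {S T U : Stonean.{u}} (f : T ⟶ S) (k : U ⟶ T) (g : G.obj.obj (op S)) :
    (G.obj.map (k ≫ f).op).hom g = (G.obj.map k.op).hom ((G.obj.map f.op).hom g) := by
  simp

theorem CRing.map_comp_hom {A : CRing.{u}} {S T U : Stonean.{u}} (f : T ⟶ S) (k : U ⟶ T)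
    (g : A.obj.obj (op S)) :
    (A.obj.map (k ≫ f).op).hom g = (A.obj.map k.op).hom ((A.obj.map f.op).hom g) := by
  simp

theorem map_app_hom {S T : Stonean.{u}} (f : T ⟶ S) (h : H.obj.obj (op S)) :
    (G.obj.map f.op).hom ((i.hom.app (op S)).hom h) =
      (i.hom.app (op T)).hom ((H.obj.map f.op).hom h) :=
  congrArg (fun k => k.hom h) (i.hom.naturality f.op).symm

variable {i}

theorem map_mem_subgroupAt {S T : Stonean.{u}} (f : T ⟶ S) {g : G.obj.obj (op S)}
    (hg : g ∈ subgroupAt i S) : (G.obj.map f.op).hom g ∈ subgroupAt i T := by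
  obtain ⟨h, rfl⟩ := hg
  exact ⟨(H.obj.map f.op).hom h, (map_app_hom i f h).symm⟩

theorem NowhereIn.map {S T : Stonean.{u}} (f : T ⟶ S) {g : G.obj.obj (op S)}
    (hg : NowhereIn i g) : NowhereIn i ((G.obj.map f.op).hom g) := fun s => by
  rw [← map_comp_hom]
  exact hg (s ≫ f)

/-- The two alternatives exclude each other only over nonempty spaces. -/
theorem NowhereIn.isEmpty {S : Stonean.{u}} {g : G.obj.obj (op S)}
    (hg : NowhereIn i g) (hg' : g ∈ subgroupAt i S) : IsEmpty S :=
  ⟨fun s => hg (ptTo s) (map_mem_subgroupAt (ptTo s) hg')⟩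

theorem NowhereIn.mul_right {S : Stonean.{u}} {g g' : G.obj.obj (op S)}
    (hg : NowhereIn i g) (hg' : g' ∈ subgroupAt i S) : NowhereIn i (g * g') := fun s h => by
  rw [map_mul] at h
  exact hg s ((Subgroup.mul_mem_cancel_right _ (map_mem_subgroupAt s hg')).1 h)

theorem NowhereIn.mul_left {S : Stonean.{u}} {g g' : G.obj.obj (op S)}
    (hg : NowhereIn i g) (hg' : g' ∈ subgroupAt i S) : NowhereIn i (g' * g) := fun s h => by
  rw [map_mul] at h
  exact hg s ((Subgroup.mul_mem_cancel_left _ (map_mem_subgroupAt s hg')).1 h)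

variable (i)

/-- The sieve of maps along which `g` becomes a section of `H` or meets `H` nowhere. -/
def decompSieve {S : Stonean.{u}} (g : G.obj.obj (op S)) : Sieve S where
  arrows T f := (G.obj.map f.op).hom g ∈ subgroupAt i T ∨ NowhereIn i ((G.obj.map f.op).hom g)
  downward_closed {T U f} h k := by
    rw [map_comp_hom]
    exact h.imp (map_mem_subgroupAt k) (NowhereIn.map k)

variable {i}

theorem map_constSection {S T : Stonean.{u}} (f : T ⟶ S) (γ : G.obj.obj (op pt.{u})) :
    (G.obj.map f.op).hom (constSection S γ) = constSection T γ :=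
  (map_comp_hom _ f γ).symm

theorem constSection_pt (γ : G.obj.obj (op pt.{u})) : constSection pt.{u} γ = γ := by
  -- The constant self-map of the one-point space is definitionally the identity.
  change (G.obj.map (𝟙 (op pt.{u}))).hom γ = γ
  simp

theorem constSection_mul {S : Stonean.{u}} (γ δ : G.obj.obj (op pt.{u})) :
    constSection S (γ * δ) = constSection S γ * constSection S δ :=
  map_mul _ _ _

theorem constSection_inv {S : Stonean.{u}} (γ : G.obj.obj (op pt.{u})) :
    constSection S γ⁻¹ = (constSection S γ)⁻¹ :=
  map_inv _ _

/-- An open subgroup is closed because its cosets are open. If `γ = g(s)` is not in `H`, then near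
`s` the section `g γ⁻¹` lies in `H`, so `g` lies in the coset `H γ`, which is disjoint from `H`. -/
theorem exists_isClopen_iff (ho : IsOpenSubgroup i) {S : Stonean.{u}} (g : G.obj.obj (op S)) :
    ∃ U : Set S, IsClopen U ∧ ∀ (T : Stonean.{u}) (f : T ⟶ S),
      (G.obj.map f.op).hom g ∈ subgroupAt i T ↔ ∀ t : T, f t ∈ U := by
  obtain ⟨U, hU, h⟩ := ho S g
  have key (g : G.obj.obj (op S)) (U : Set S) (h : ∀ (T : Stonean.{u}) (f : T ⟶ S),
      (G.obj.map f.op).hom g ∈ subgroupAt i T ↔ ∀ t : T, f t ∈ U) (s : S) :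
      (G.obj.map (ptTo s).op).hom g ∈ subgroupAt i pt.{u} ↔ s ∈ U :=
    (h _ (ptTo s)).trans ⟨fun h => h PUnit.unit, fun h _ => h⟩
  refine ⟨U, ⟨⟨isOpen_iff_forall_mem_open.2 fun s hs => ?_⟩, hU⟩, h⟩
  obtain ⟨V, hV, h'⟩ := ho S (g * (constSection S ((G.obj.map (ptTo s).op).hom g))⁻¹)
  have e (v : S) : (G.obj.map (ptTo v).op).hom
      (g * (constSection S ((G.obj.map (ptTo s).op).hom g))⁻¹) =
      (G.obj.map (ptTo v).op).hom g * ((G.obj.map (ptTo s).op).hom g)⁻¹ := by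
    rw [map_mul, map_inv, map_constSection, constSection_pt]
  refine ⟨V, fun v hv hv' => hs ?_, hV, ?_⟩
  · rw [← key _ _ h', e] at hv
    rw [← key _ _ h] at hv' ⊢
    have := Subgroup.mul_mem _ (Subgroup.inv_mem _ hv) hv'
    simpa using this
  · rw [← key _ _ h', e, mul_inv_cancel]
    exact Subgroup.one_mem _

/-- The clopen locus where `g` lies in `H` and its complement are extremally disconnected and
together cover `S`. -/
theorem decompSieve_mem (ho : IsOpenSubgroup i) {S : Stonean.{u}} (g : G.obj.obj (op S)) :
    decompSieve i g ∈ site.{u} S := by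
  obtain ⟨U, hU, h⟩ := exists_isClopen_iff ho g
  obtain ⟨T, f, hf⟩ := exists_clopen_incl hU
  obtain ⟨T', f', hf'⟩ := exists_clopen_incl hU.compl
  refine mem_site_of_jointly_surjective (α := Bool) (fun b => cond b T T')
    (fun b => match b with | true => f | false => f') (fun s => ?_) (fun b => ?_)
  · by_cases hs : s ∈ U
    · rw [← hf] at hs
      exact ⟨true, hs⟩
    · rw [← Set.mem_compl_iff, ← hf'] at hs
      exact ⟨false, hs⟩
  · match b with
    | true => exact Or.inl ((h T f).2 fun t => hf ▸ ⟨t, rfl⟩)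
    | false =>
      refine Or.inr fun s hs => ?_
      rw [← map_comp_hom, h] at hs
      have : f' (s PUnit.unit) ∈ Uᶜ := hf' ▸ ⟨_, rfl⟩
      exact this (hs PUnit.unit)

theorem finite_iInf_mem {ι : Type} [Finite ι] {S : Stonean.{u}} (P : ι → Sieve S)
    (hP : ∀ k, P k ∈ site.{u} S) : (⨅ k, P k) ∈ site.{u} S := by
  classical
  have := Fintype.ofFinite ι
  rw [← Finset.inf_univ_eq_iInf]
  induction (Finset.univ : Finset ι) using Finset.induction with
  | empty => simp
  | insert a s _ hs =>
    rw [Finset.inf_insert]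
    exact site.intersection_covering (hP a) hs

end Decomp

/-! ### Additive maps out of a sheafified ring -/

section Extension

variable (P : Stonean.{u}ᵒᵖ ⥤ RingCat.{u + 1})

/-- The universal property of sheafification in rings provides only ring homomorphisms, whereas the
projection `R[G] → R[H]` is merely additive. After forgetting to abelian groups, the unit remains
locally bijective, so morphisms into a sheaf still extend along it. -/
theorem exists_extend_sheafify {A : CRing.{u}}
    (ψ : ∀ S : Stonean.{u}, P.obj (op S) →+ A.obj.obj (op S))
    (hψ : ∀ (S T : Stonean.{u}) (f : T ⟶ S) (b : P.obj (op S)),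
      (A.obj.map f.op).hom (ψ S b) = ψ T ((P.map f.op).hom b)) :
    ∃ π : ∀ S : Stonean.{u},
        ((presheafToSheaf site RingCat.{u + 1}).obj P).obj.obj (op S) →+ A.obj.obj (op S),
      (∀ (S T : Stonean.{u}) (f : T ⟶ S)
        (x : ((presheafToSheaf site RingCat.{u + 1}).obj P).obj.obj (op S)),
        (A.obj.map f.op).hom (π S x) =
          π T ((((presheafToSheaf site RingCat.{u + 1}).obj P).obj.map f.op).hom x)) ∧
      ∀ (S : Stonean.{u}) (b : P.obj (op S)),
        π S (((toSheafify site P).app (op S)).hom b) = ψ S b := by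
  let F := forget₂ RingCat.{u + 1} AddCommGrpCat.{u + 1}
  let k : P ⋙ F ⟶ (sheafify site P) ⋙ F := Functor.whiskerRight (toSheafify site P) F
  have : Presheaf.IsLocallyInjective site k := by
    constructor
    intro X x y h
    have := Presheaf.equalizerSieve_mem site (toSheafify site P) (X := X) x y h
    exact this
  have : Presheaf.IsLocallySurjective site k := by
    constructor
    intro X x
    have := Presheaf.imageSieve_mem site (toSheafify site P) (U := op X) x
    exact this
  have hA : Presheaf.IsSheaf site (A.obj ⋙ F) :=
    (Presheaf.isSheaf_iff_isSheaf_forget _ _ (forget AddCommGrpCat.{u + 1})).2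
      ((isSheaf_iff_isSheaf_of_type _ _).2 A.isSheaf_forget)
  let ψ' : P ⋙ F ⟶ A.obj ⋙ F :=
    { app := fun S => AddCommGrpCat.ofHom (ψ S.unop)
      naturality := fun S T f => by
        ext b
        exact (hψ S.unop T.unop f.unop b).symm }
  obtain ⟨π, hπ⟩ := (site.W_of_isLocallyBijective k _ hA).2 ψ'
  refine ⟨fun S => (π.app (op S)).hom, fun S T f x => ?_, fun S b => ?_⟩
  · exact congrArg (fun k => k.hom x) (π.naturality f.op).symm
  · exact congrArg (fun k : P ⋙ F ⟶ A.obj ⋙ F => (k.app (op S)).hom b) hπ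

end Extension

/-! ### Sections of condensed group rings -/

section GroupRingApi

variable (R : CRing.{u}) {G H : CGrp.{u}}

/-- The canonical map `R(S)[G(S)] → R[G](S)`. -/
def groupRing.ofAlgebra (G : CGrp.{u}) (S : Stonean.{u}) :
    MonoidAlgebra (R.obj.obj (op S)) (G.obj.obj (op S)) →+* (groupRing R G).obj.obj (op S) :=
  ((toSheafify site (groupRingPresheaf R G)).app (op S)).hom

/-- The section `r[g]` of `R[G]`. -/
def groupRing.single {S : Stonean.{u}} (g : G.obj.obj (op S)) (r : R.obj.obj (op S)) :
    (groupRing R G).obj.obj (op S) :=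
  groupRing.ofAlgebra R G S (MonoidAlgebra.single g r)

/-- The map `R(S)[G(S)] → R(T)[G(T)]` along `T → S`. -/
def groupRing.algebraRes (G : CGrp.{u}) {S T : Stonean.{u}} (f : T ⟶ S) :
    MonoidAlgebra (R.obj.obj (op S)) (G.obj.obj (op S)) →+*
      MonoidAlgebra (R.obj.obj (op T)) (G.obj.obj (op T)) :=
  (MonoidAlgebra.mapDomainRingHom _ (G.obj.map f.op).hom).comp
    (MonoidAlgebra.mapRingHom _ (R.obj.map f.op).hom)

theorem groupRing.algebraRes_single {S T : Stonean.{u}} (f : T ⟶ S) (g : G.obj.obj (op S))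
    (r : R.obj.obj (op S)) :
    groupRing.algebraRes R G f (MonoidAlgebra.single g r) =
      MonoidAlgebra.single ((G.obj.map f.op).hom g) ((R.obj.map f.op).hom r) := by
  simp [groupRing.algebraRes]

theorem groupRing.map_ofAlgebra {S T : Stonean.{u}} (f : T ⟶ S)
    (b : MonoidAlgebra (R.obj.obj (op S)) (G.obj.obj (op S))) :
    ((groupRing R G).obj.map f.op).hom (groupRing.ofAlgebra R G S b) =
      groupRing.ofAlgebra R G T (groupRing.algebraRes R G f b) :=
  congrArg (fun k => k.hom b)
    ((toSheafify site (groupRingPresheaf R G)).naturality f.op).symm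

theorem groupRing.map_single {S T : Stonean.{u}} (f : T ⟶ S) (g : G.obj.obj (op S))
    (r : R.obj.obj (op S)) :
    ((groupRing R G).obj.map f.op).hom (groupRing.single R g r) =
      groupRing.single R ((G.obj.map f.op).hom g) ((R.obj.map f.op).hom r) := by
  rw [groupRing.single, groupRing.map_ofAlgebra, groupRing.single]
  rw [groupRing.algebraRes_single]

theorem groupRing.map_of {S T : Stonean.{u}} (f : T ⟶ S) (g : G.obj.obj (op S)) :
    ((groupRing R G).obj.map f.op).hom (groupRing.of R g) =
      groupRing.of R ((G.obj.map f.op).hom g) :=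
  (groupRing.map_single R f g 1).trans (by rw [map_one]; rfl)

theorem groupRing.single_mul_single {S : Stonean.{u}} (g g' : G.obj.obj (op S))
    (r r' : R.obj.obj (op S)) :
    groupRing.single R g r * groupRing.single R g' r' = groupRing.single R (g * g') (r * r') := by
  rw [groupRing.single, groupRing.single, ← map_mul, MonoidAlgebra.single_mul_single]
  rfl

theorem groupRing.single_mul_of {S : Stonean.{u}} (g g' : G.obj.obj (op S))
    (r : R.obj.obj (op S)) :
    groupRing.single R g r * groupRing.of R g' = groupRing.single R (g * g') r :=
  (groupRing.single_mul_single R g g' r 1).trans (by rw [mul_one])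

theorem groupRing.of_mul_single {S : Stonean.{u}} (g g' : G.obj.obj (op S))
    (r : R.obj.obj (op S)) :
    groupRing.of R g * groupRing.single R g' r = groupRing.single R (g * g') r :=
  (groupRing.single_mul_single R g g' 1 r).trans (by rw [one_mul])

theorem groupRing.of_one {S : Stonean.{u}} :
    groupRing.of R (1 : G.obj.obj (op S)) = 1 :=
  map_one (groupRing.ofAlgebra R G S)

theorem groupRing.of_mul {S : Stonean.{u}} (g g' : G.obj.obj (op S)) :
    groupRing.of R (g * g') = groupRing.of R g * groupRing.of R g' :=
  (groupRing.of_mul_single R g g' 1).symm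

theorem groupRingMap_ofAlgebra (i : H ⟶ G) {S : Stonean.{u}}
    (b : MonoidAlgebra (R.obj.obj (op S)) (H.obj.obj (op S))) :
    ((groupRingMap R i).hom.app (op S)).hom (groupRing.ofAlgebra R H S b) =
      groupRing.ofAlgebra R G S
        (MonoidAlgebra.mapDomainRingHom _ (i.hom.app (op S)).hom b) :=
  (congrArg (fun k : groupRingPresheaf R H ⟶ (groupRing R G).obj => (k.app (op S)).hom b)
    (toSheafify_naturality site _)).symm

theorem groupRingMap_single (i : H ⟶ G) {S : Stonean.{u}} (h : H.obj.obj (op S))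
    (r : R.obj.obj (op S)) :
    ((groupRingMap R i).hom.app (op S)).hom (groupRing.single R h r) =
      groupRing.single R ((i.hom.app (op S)).hom h) r := by
  rw [groupRing.single, groupRingMap_ofAlgebra, groupRing.single]
  simp

theorem groupRing.ofAlgebra_locallySurjective {S : Stonean.{u}}
    (x : (groupRing R G).obj.obj (op S)) : ∃ P ∈ site.{u} S, ∀ (T : Stonean.{u}) (f : T ⟶ S), P f →
      ∃ b, groupRing.ofAlgebra R G T b = ((groupRing R G).obj.map f.op).hom x :=
  ⟨_, Presheaf.imageSieve_mem site (toSheafify site (groupRingPresheaf R G)) x,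
    fun _ _ h => h⟩

/-- To prove a local and additive property of the sections of a condensed group ring, it suffices
to prove it for the sections `r[g]`. -/
theorem groupRing.induction {p : ∀ S : Stonean.{u}, (groupRing R G).obj.obj (op S) → Prop}
    (loc : ∀ (S : Stonean.{u}) (x : (groupRing R G).obj.obj (op S)) (P : Sieve S),
      P ∈ site.{u} S → (∀ (T : Stonean.{u}) (f : T ⟶ S), P f →
        p T (((groupRing R G).obj.map f.op).hom x)) → p S x)
    (add : ∀ (S : Stonean.{u}) (x y : (groupRing R G).obj.obj (op S)), p S x → p S y → p S (x + y))
    (single : ∀ (S : Stonean.{u}) (g : G.obj.obj (op S)) (r : R.obj.obj (op S)),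
      p S (groupRing.single R g r))
    (S : Stonean.{u}) (x : (groupRing R G).obj.obj (op S)) : p S x := by
  obtain ⟨P, hP, h⟩ := groupRing.ofAlgebra_locallySurjective R x
  refine loc S x P hP fun T f hf => ?_
  obtain ⟨b, hb⟩ := h T f hf
  rw [← hb]
  clear hb
  induction b using MonoidAlgebra.induction_linear with
  -- There is no separate hypothesis for zero, which is the section `0[1]`.
  | zero => simpa [groupRing.single] using single T 1 0
  | add x y hx hy => rw [map_add]; exact add _ _ _ hx hy
  | single g r => exact single T g r

/-- A natural family of additive maps `R(S)[G(S)] → A(S)` into a condensed ring extends to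
`R[G]`. -/
theorem groupRing.exists_extend {A : CRing.{u}}
    (ψ : ∀ S : Stonean.{u}, MonoidAlgebra (R.obj.obj (op S)) (G.obj.obj (op S)) →+
      A.obj.obj (op S))
    (hψ : ∀ (S T : Stonean.{u}) (f : T ⟶ S)
      (b : MonoidAlgebra (R.obj.obj (op S)) (G.obj.obj (op S))),
      (A.obj.map f.op).hom (ψ S b) = ψ T (groupRing.algebraRes R G f b)) :
    ∃ π : ∀ S : Stonean.{u}, (groupRing R G).obj.obj (op S) →+ A.obj.obj (op S),
      (∀ (S T : Stonean.{u}) (f : T ⟶ S) (x : (groupRing R G).obj.obj (op S)),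
        (A.obj.map f.op).hom (π S x) = π T (((groupRing R G).obj.map f.op).hom x)) ∧
      ∀ (S : Stonean.{u}) (b : MonoidAlgebra (R.obj.obj (op S)) (G.obj.obj (op S))),
        π S (groupRing.ofAlgebra R G S b) = ψ S b :=
  exists_extend_sheafify (groupRingPresheaf R G) ψ hψ

end GroupRingApi

/-! ### The bimodule projection from `R[G]` to `R[H]` -/

section Projection

variable (R : CRing.{u}) {G H : CGrp.{u}} {i : H ⟶ G}

variable (i) in
/-- The section `a` of `R[H]` is `[h]` if `g = h` is a section of `H`, and it is zero if `g` meets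
`H` nowhere. -/
def IsSubgroupPart {S : Stonean.{u}} (g : G.obj.obj (op S))
    (a : (groupRing R H).obj.obj (op S)) : Prop :=
  (∀ h : H.obj.obj (op S), (i.hom.app (op S)).hom h = g → a = groupRing.of R h) ∧
    (NowhereIn i g → a = 0)

variable {R}

/-- Injectivity of `i` makes the section of `H` over `g` unique. The second clause can apply only
over the empty space, where all sections agree. -/
theorem IsSubgroupPart.of_mem (hi : IsSubgroup i) {S : Stonean.{u}} (h : H.obj.obj (op S)) :
    IsSubgroupPart R i ((i.hom.app (op S)).hom h) (groupRing.of R h) :=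
  ⟨fun h' e => by rw [hi S e], fun hn =>
    have := hn.isEmpty ⟨h, rfl⟩
    CRing.eq_of_isEmpty _ _⟩

theorem IsSubgroupPart.zero {S : Stonean.{u}} {g : G.obj.obj (op S)} (hg : NowhereIn i g) :
    IsSubgroupPart R i g 0 :=
  ⟨fun h e =>
    have := hg.isEmpty ⟨h, e⟩
    CRing.eq_of_isEmpty _ _, fun _ => rfl⟩

/-- The dichotomy for `g` cannot be dropped: without it both clauses hold vacuously for every `a`,
although they may become restrictive after pulling back. The same remark applies to uniqueness
below. -/
theorem IsSubgroupPart.map (hi : IsSubgroup i) {S T : Stonean.{u}} (f : T ⟶ S)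
    {g : G.obj.obj (op S)} (hg : g ∈ subgroupAt i S ∨ NowhereIn i g)
    {a : (groupRing R H).obj.obj (op S)} (ha : IsSubgroupPart R i g a) :
    IsSubgroupPart R i ((G.obj.map f.op).hom g) (((groupRing R H).obj.map f.op).hom a) := by
  obtain ⟨h, rfl⟩ | hg := hg
  · rw [ha.1 h rfl, groupRing.map_of, map_app_hom]
    exact .of_mem hi _
  · rw [ha.2 hg, map_zero]
    exact .zero (hg.map f)

theorem IsSubgroupPart.unique {S : Stonean.{u}}
    {g : G.obj.obj (op S)} (hg : g ∈ subgroupAt i S ∨ NowhereIn i g)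
    {a a' : (groupRing R H).obj.obj (op S)} (ha : IsSubgroupPart R i g a)
    (ha' : IsSubgroupPart R i g a') : a = a' := by
  obtain ⟨h, rfl⟩ | hg := hg
  · rw [ha.1 h rfl, ha'.1 h rfl]
  · rw [ha.2 hg, ha'.2 hg]

theorem IsSubgroupPart.exists (hi : IsSubgroup i) {S : Stonean.{u}}
    {g : G.obj.obj (op S)} (hg : g ∈ subgroupAt i S ∨ NowhereIn i g) :
    ∃ a, IsSubgroupPart R i g a := by
  obtain ⟨h, rfl⟩ | hg := hg
  · exact ⟨_, .of_mem hi h⟩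
  · exact ⟨_, .zero hg⟩

variable (R)

/-- The required section exists on each member of the cover `decompSieve i g`. Uniqueness there
makes the local choices compatible, so they glue. -/
theorem exists_subgroupPart (hi : IsSubgroup i) (ho : IsOpenSubgroup i) {S : Stonean.{u}}
    (g : G.obj.obj (op S)) :
    ∃ a : (groupRing R H).obj.obj (op S), ∀ (T : Stonean.{u}) (f : T ⟶ S), decompSieve i g f →
      IsSubgroupPart R i ((G.obj.map f.op).hom g) (((groupRing R H).obj.map f.op).hom a) := by
  choose x hx using fun (T : Stonean.{u}) (f : T ⟶ S) (hf : decompSieve i g f) =>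
    IsSubgroupPart.exists (R := R) hi hf
  obtain ⟨a, ha, -⟩ := (groupRing R H).isSheaf_forget _ (decompSieve_mem ho g)
    (fun T f hf => x T f hf) (by
      intro T₁ T₂ W k₁ k₂ f₁ f₂ h₁ h₂ e
      have hW : decompSieve i g (k₁ ≫ f₁) := (decompSieve i g).downward_closed h₁ k₁
      refine IsSubgroupPart.unique hW ?_ ?_
      · rw [map_comp_hom]
        exact (hx _ _ h₁).map hi k₁ h₁
      · rw [e, map_comp_hom]
        exact (hx _ _ h₂).map hi k₂ h₂)
  refine ⟨a, fun T f hf => ?_⟩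
  have : ((groupRing R H).obj.map f.op).hom a = x T f hf := ha f hf
  rw [this]
  exact hx T f hf

/-- The component in `R[H]` of the section `[g]` of `R[G]`. -/
def subgroupPart (hi : IsSubgroup i) (ho : IsOpenSubgroup i) {S : Stonean.{u}}
    (g : G.obj.obj (op S)) : (groupRing R H).obj.obj (op S) :=
  (exists_subgroupPart R hi ho g).choose

theorem isSubgroupPart_subgroupPart (hi : IsSubgroup i) (ho : IsOpenSubgroup i) {S : Stonean.{u}}
    {g : G.obj.obj (op S)} (hg : g ∈ subgroupAt i S ∨ NowhereIn i g) :
    IsSubgroupPart R i g (subgroupPart R hi ho g) := by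
  have := (exists_subgroupPart R hi ho g).choose_spec S (𝟙 S) (by simpa [decompSieve] using hg)
  simpa [subgroupPart] using this

theorem map_subgroupPart (hi : IsSubgroup i) (ho : IsOpenSubgroup i) {S T : Stonean.{u}}
    (f : T ⟶ S) (g : G.obj.obj (op S)) :
    ((groupRing R H).obj.map f.op).hom (subgroupPart R hi ho g) =
      subgroupPart R hi ho ((G.obj.map f.op).hom g) := by
  refine CRing.ext_of_cover (decompSieve_mem ho ((G.obj.map f.op).hom g)) fun U k hk => ?_
  refine IsSubgroupPart.unique hk ?_ ((exists_subgroupPart R hi ho _).choose_spec U k hk)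
  rw [← map_comp_hom, ← CRing.map_comp_hom]
  refine (exists_subgroupPart R hi ho g).choose_spec U (k ≫ f) ?_
  change _ ∨ _
  rw [map_comp_hom]
  exact hk

theorem exists_groupRingProj (hi : IsSubgroup i) (ho : IsOpenSubgroup i) :
    ∃ π : ∀ S : Stonean.{u}, (groupRing R G).obj.obj (op S) →+ (groupRing R H).obj.obj (op S),
      (∀ (S T : Stonean.{u}) (f : T ⟶ S) (x : (groupRing R G).obj.obj (op S)),
        ((groupRing R H).obj.map f.op).hom (π S x) =
          π T (((groupRing R G).obj.map f.op).hom x)) ∧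
      ∀ (S : Stonean.{u}) (g : G.obj.obj (op S)) (r : R.obj.obj (op S)),
        π S (groupRing.single R g r) = groupRing.single R 1 r * subgroupPart R hi ho g := by
  obtain ⟨π, h, h'⟩ := groupRing.exists_extend R (G := G) (A := groupRing R H)
    -- On `R(S)[G(S)]` the map is `r[g] ↦ r[1] · a`, where `a` is the `R[H]`-component of `[g]`.
    (fun S => MonoidAlgebra.liftNC
      ((groupRing.ofAlgebra R H S).comp MonoidAlgebra.singleOneRingHom).toAddMonoidHom
      (fun g => subgroupPart R hi ho g)) (fun S T f b => by
        induction b using MonoidAlgebra.induction_linear with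
        | zero => simp only [map_zero]
        | add x y hx hy => simp only [map_add, hx, hy]
        | single g r =>
          rw [groupRing.algebraRes_single, MonoidAlgebra.liftNC_single,
            MonoidAlgebra.liftNC_single, map_mul, map_subgroupPart]
          congr 1
          refine (groupRing.map_single R f 1 r).trans ?_
          rw [map_one]
          rfl)
  exact ⟨π, h, fun S g r => (h' S _).trans (MonoidAlgebra.liftNC_single _ _ _ _)⟩

/-- The projection of `R[G]` onto `R[H]` that kills the sections `[g]` such that `g` meets `H`
nowhere. -/
def groupRingProj (hi : IsSubgroup i) (ho : IsOpenSubgroup i) (S : Stonean.{u}) :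
    (groupRing R G).obj.obj (op S) →+ (groupRing R H).obj.obj (op S) :=
  (exists_groupRingProj R hi ho).choose S

variable {R} (hi : IsSubgroup i) (ho : IsOpenSubgroup i)

theorem map_groupRingProj {S T : Stonean.{u}} (f : T ⟶ S) (x : (groupRing R G).obj.obj (op S)) :
    ((groupRing R H).obj.map f.op).hom (groupRingProj R hi ho S x) =
      groupRingProj R hi ho T (((groupRing R G).obj.map f.op).hom x) :=
  (exists_groupRingProj R hi ho).choose_spec.1 S T f x

theorem groupRingProj_single_of_mem {S : Stonean.{u}} (h : H.obj.obj (op S))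
    (r : R.obj.obj (op S)) :
    groupRingProj R hi ho S (groupRing.single R ((i.hom.app (op S)).hom h) r) =
      groupRing.single R h r := by
  rw [groupRingProj, (exists_groupRingProj R hi ho).choose_spec.2,
    (isSubgroupPart_subgroupPart R hi ho (.inl ⟨h, rfl⟩)).1 h rfl, groupRing.single_mul_of, one_mul]

theorem groupRingProj_single_of_nowhereIn {S : Stonean.{u}} {g : G.obj.obj (op S)}
    (hg : NowhereIn i g) (r : R.obj.obj (op S)) :
    groupRingProj R hi ho S (groupRing.single R g r) = 0 := by
  rw [groupRingProj, (exists_groupRingProj R hi ho).choose_spec.2,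
    (isSubgroupPart_subgroupPart R hi ho (.inr hg)).2 hg, mul_zero]

variable (i) in
include ho in
/-- To prove a local and additive property of the sections of `R[G]`, it suffices to prove it for
the sections `r[g]` such that finitely many translates of `g` lie in `H` or meet `H` nowhere. -/
theorem groupRing.induction_decomp {ι : Type} [Finite ι] (γ : ι → G.obj.obj (op pt.{u}))
    {p : ∀ S : Stonean.{u}, (groupRing R G).obj.obj (op S) → Prop}
    (loc : ∀ (S : Stonean.{u}) (x : (groupRing R G).obj.obj (op S)) (P : Sieve S),
      P ∈ site.{u} S → (∀ (T : Stonean.{u}) (f : T ⟶ S), P f →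
        p T (((groupRing R G).obj.map f.op).hom x)) → p S x)
    (add : ∀ (S : Stonean.{u}) (x y : (groupRing R G).obj.obj (op S)), p S x → p S y → p S (x + y))
    (single : ∀ (S : Stonean.{u}) (g : G.obj.obj (op S)) (r : R.obj.obj (op S)),
      (∀ k, constSection S (γ k) * g ∈ subgroupAt i S ∨ NowhereIn i (constSection S (γ k) * g)) →
      (∀ k, g * (constSection S (γ k)) ∈ subgroupAt i S ∨ NowhereIn i (g * (constSection S (γ k)))) →
      p S (groupRing.single R g r))
    (S : Stonean.{u}) (x : (groupRing R G).obj.obj (op S)) : p S x := by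
  refine groupRing.induction R loc add (fun S g r => ?_) S x
  -- Finitely many translates are split simultaneously by intersecting their covering sieves.
  refine loc S _ _ (site.intersection_covering
    (finite_iInf_mem _ fun k => decompSieve_mem ho (constSection S (γ k) * g))
    (finite_iInf_mem _ fun k => decompSieve_mem ho (g * constSection S (γ k)))) ?_
  rintro T f ⟨hf, hf'⟩
  rw [groupRing.map_single]
  refine single T _ _ (fun k => ?_) (fun k => ?_)
  · simpa [decompSieve, map_constSection] using
      iInf_le (fun k => decompSieve i (constSection S (γ k) * g)) k _ hf
  · simpa [decompSieve, map_constSection] using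
      iInf_le (fun k => decompSieve i (g * constSection S (γ k))) k _ hf'

variable (i) in
include ho in
-- This is the case of the single trivial translate.
theorem groupRing.induction_mem {p : ∀ S : Stonean.{u}, (groupRing R G).obj.obj (op S) → Prop}
    (loc : ∀ (S : Stonean.{u}) (x : (groupRing R G).obj.obj (op S)) (P : Sieve S),
      P ∈ site.{u} S → (∀ (T : Stonean.{u}) (f : T ⟶ S), P f →
        p T (((groupRing R G).obj.map f.op).hom x)) → p S x)
    (add : ∀ (S : Stonean.{u}) (x y : (groupRing R G).obj.obj (op S)), p S x → p S y → p S (x + y))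
    (single : ∀ (S : Stonean.{u}) (g : G.obj.obj (op S)) (r : R.obj.obj (op S)),
      g ∈ subgroupAt i S ∨ NowhereIn i g → p S (groupRing.single R g r))
    (S : Stonean.{u}) (x : (groupRing R G).obj.obj (op S)) : p S x :=
  groupRing.induction_decomp i ho (fun _ : Unit => 1) loc add
    (fun S g r h _ => single S g r (by simpa [constSection] using h ())) S x

theorem groupRingProj_mul_map (S : Stonean.{u}) (b : (groupRing R G).obj.obj (op S))
    (a : (groupRing R H).obj.obj (op S)) :
    groupRingProj R hi ho S (b * ((groupRingMap R i).hom.app (op S)).hom a) =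
      groupRingProj R hi ho S b * a := by
  -- The induction changes the base `S`, so the other factor has to be quantified within the
  -- property.
  revert b
  refine groupRing.induction R (p := fun S a => ∀ b, groupRingProj R hi ho S
    (b * ((groupRingMap R i).hom.app (op S)).hom a) = groupRingProj R hi ho S b * a) ?_ ?_ ?_ S a
  · intro S a P hP h b
    refine CRing.ext_of_cover hP fun T f hf => ?_
    rw [map_groupRingProj, RingHom.map_mul, hom_naturality, h T f hf, RingHom.map_mul,
      map_groupRingProj]
  · intro S x y hx hy b
    rw [map_add, mul_add, map_add, hx, hy, mul_add]
  · intro S h r b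
    revert h r
    refine groupRing.induction_mem i ho (p := fun S b => ∀ (h : H.obj.obj (op S))
      (r : R.obj.obj (op S)), groupRingProj R hi ho S (b * ((groupRingMap R i).hom.app (op S)).hom
        (groupRing.single R h r)) = groupRingProj R hi ho S b * groupRing.single R h r) ?_ ?_ ?_ S b
    · intro S b P hP hb h r
      refine CRing.ext_of_cover hP fun T f hf => ?_
      rw [map_groupRingProj, RingHom.map_mul, hom_naturality, groupRing.map_single, hb T f hf,
        RingHom.map_mul, groupRing.map_single, map_groupRingProj]
    · intro S x y hx hy h r
      rw [add_mul, map_add, hx, hy, map_add, add_mul]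
    · intro S g r' hg h r
      rw [groupRingMap_single, groupRing.single_mul_single]
      obtain ⟨h', rfl⟩ | hg := hg
      · rw [← map_mul, groupRingProj_single_of_mem, groupRingProj_single_of_mem,
          groupRing.single_mul_single]
      · rw [groupRingProj_single_of_nowhereIn hi ho (hg.mul_right ⟨h, rfl⟩),
          groupRingProj_single_of_nowhereIn hi ho hg, zero_mul]

theorem groupRingProj_map_mul (S : Stonean.{u}) (b : (groupRing R G).obj.obj (op S))
    (a : (groupRing R H).obj.obj (op S)) :
    groupRingProj R hi ho S (((groupRingMap R i).hom.app (op S)).hom a * b) =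
      a * groupRingProj R hi ho S b := by
  revert b
  refine groupRing.induction R (p := fun S a => ∀ b, groupRingProj R hi ho S
    (((groupRingMap R i).hom.app (op S)).hom a * b) = a * groupRingProj R hi ho S b) ?_ ?_ ?_ S a
  · intro S a P hP h b
    refine CRing.ext_of_cover hP fun T f hf => ?_
    rw [map_groupRingProj, RingHom.map_mul, hom_naturality, h T f hf, RingHom.map_mul,
      map_groupRingProj]
  · intro S x y hx hy b
    rw [map_add, add_mul, map_add, hx, hy, add_mul]
  · intro S h r b
    revert h r
    refine groupRing.induction_mem i ho (p := fun S b => ∀ (h : H.obj.obj (op S))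
      (r : R.obj.obj (op S)), groupRingProj R hi ho S (((groupRingMap R i).hom.app (op S)).hom
        (groupRing.single R h r) * b) = groupRing.single R h r * groupRingProj R hi ho S b) ?_ ?_ ?_
        S b
    · intro S b P hP hb h r
      refine CRing.ext_of_cover hP fun T f hf => ?_
      rw [map_groupRingProj, RingHom.map_mul, hom_naturality, groupRing.map_single, hb T f hf,
        RingHom.map_mul, groupRing.map_single, map_groupRingProj]
    · intro S x y hx hy h r
      rw [mul_add, map_add, hx, hy, map_add, mul_add]
    · intro S g r' hg h r
      rw [groupRingMap_single, groupRing.single_mul_single]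
      obtain ⟨h', rfl⟩ | hg := hg
      · rw [← map_mul, groupRingProj_single_of_mem, groupRingProj_single_of_mem,
          groupRing.single_mul_single]
      · rw [groupRingProj_single_of_nowhereIn hi ho (hg.mul_left ⟨h, rfl⟩),
          groupRingProj_single_of_nowhereIn hi ho hg, mul_zero]

end Projection

/-! ### Coset representatives as dual bases -/

section Representatives

variable {R : CRing.{u}} {G H : CGrp.{u}} {i : H ⟶ G}

/-- Each `w k` is in the same case at all points of `S`, so a single point decides which of them
lies in `H` over the whole of `S`. -/
theorem isEmpty_or_exists_mem {ι : Type} {S : Stonean.{u}} (w : ι → G.obj.obj (op S))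
    (hw : ∀ k, w k ∈ subgroupAt i S ∨ NowhereIn i (w k))
    (h : ∀ s : pt.{u} ⟶ S, ∃! k, (G.obj.map s.op).hom (w k) ∈ subgroupAt i pt.{u}) :
    IsEmpty S ∨ ∃ k, w k ∈ subgroupAt i S ∧ ∀ l, l ≠ k → NowhereIn i (w l) := by
  obtain hS | ⟨⟨s⟩⟩ := isEmpty_or_nonempty S
  · exact .inl hS
  obtain ⟨k, hk, hk'⟩ := h (ptTo s)
  exact .inr ⟨k, (hw k).resolve_right fun h => h _ hk, fun l hl =>
    (hw l).resolve_left fun h => hl (hk' l (map_mem_subgroupAt _ h))⟩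

variable {n : ℕ} {r : Fin n → G.obj.obj (op pt.{u})}
  (hr : ∀ γ : G.obj.obj (op pt.{u}), ∃! k, γ * (r k)⁻¹ ∈ subgroupAt i pt.{u})
  (hi : IsSubgroup i) (ho : IsOpenSubgroup i)

include hr

/-- For `b = a[g]` with all `g r_k⁻¹` decomposed, only the index with `g r_k⁻¹` in `H` contributes,
and its term is `a[g r_k⁻¹] [r_k] = a[g]`. -/
theorem sum_map_groupRingProj_mul (S : Stonean.{u}) (b : (groupRing R G).obj.obj (op S)) :
    ∑ k, ((groupRingMap R i).hom.app (op S)).hom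
        (groupRingProj R hi ho S (b * groupRing.of R (constSection S (r k)⁻¹))) *
      groupRing.of R (constSection S (r k)) = b := by
  refine groupRing.induction_decomp i ho (fun k => (r k)⁻¹) (p := fun S b =>
    ∑ k, ((groupRingMap R i).hom.app (op S)).hom
        (groupRingProj R hi ho S (b * groupRing.of R (constSection S (r k)⁻¹))) *
      groupRing.of R (constSection S (r k)) = b) ?_ ?_ ?_ S b
  · intro S b P hP h
    refine CRing.ext_of_cover hP fun T f hf => Eq.trans ?_ (h T f hf)
    rw [map_sum]
    refine Finset.sum_congr rfl fun k _ => ?_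
    rw [RingHom.map_mul, hom_naturality, map_groupRingProj, RingHom.map_mul, groupRing.map_of,
      groupRing.map_of, map_constSection, map_constSection]
  · intro S x y hx hy
    simp only [add_mul, map_add, Finset.sum_add_distrib, hx, hy]
  · intro S g a _ hg
    simp only [groupRing.single_mul_of]
    obtain hS | ⟨k, ⟨h, hk⟩, hl⟩ := isEmpty_or_exists_mem _ hg fun s => by
      simpa [constSection_inv, map_constSection, constSection_pt] using
        hr ((G.obj.map s.op).hom g)
    · exact CRing.eq_of_isEmpty _ _
    · rw [Finset.sum_eq_single k]
      · rw [← hk, groupRingProj_single_of_mem, groupRingMap_single, groupRing.single_mul_of, hk,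
          mul_assoc, ← constSection_mul, inv_mul_cancel, constSection, map_one, mul_one]
      · intro l _ hlk
        rw [groupRingProj_single_of_nowhereIn hi ho (hl l hlk), map_zero, zero_mul]
      · simp

theorem sum_mul_map_groupRingProj (S : Stonean.{u}) (b : (groupRing R G).obj.obj (op S)) :
    ∑ k, groupRing.of R (constSection S (r k)⁻¹) * ((groupRingMap R i).hom.app (op S)).hom
        (groupRingProj R hi ho S (groupRing.of R (constSection S (r k)) * b)) = b := by
  refine groupRing.induction_decomp i ho r (p := fun S b =>
    ∑ k, groupRing.of R (constSection S (r k)⁻¹) * ((groupRingMap R i).hom.app (op S)).hom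
        (groupRingProj R hi ho S (groupRing.of R (constSection S (r k)) * b)) = b) ?_ ?_ ?_ S b
  · intro S b P hP h
    refine CRing.ext_of_cover hP fun T f hf => Eq.trans ?_ (h T f hf)
    rw [map_sum]
    refine Finset.sum_congr rfl fun k _ => ?_
    rw [RingHom.map_mul, hom_naturality, map_groupRingProj, RingHom.map_mul, groupRing.map_of,
      groupRing.map_of, map_constSection, map_constSection]
  · intro S x y hx hy
    simp only [mul_add, map_add, Finset.sum_add_distrib, hx, hy]
  · intro S g a hg _
    simp only [groupRing.of_mul_single]
    obtain hS | ⟨k, ⟨h, hk⟩, hl⟩ := isEmpty_or_exists_mem _ hg fun s => by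
      -- Inverses of right coset representatives represent left cosets, so the hypothesis is applied
      -- to `g(s)⁻¹`.
      have e (k : Fin n) : (G.obj.map s.op).hom (constSection S (r k) * g) ∈ subgroupAt i pt.{u} ↔
          ((G.obj.map s.op).hom g)⁻¹ * (r k)⁻¹ ∈ subgroupAt i pt.{u} := by
        rw [← Subgroup.inv_mem_iff, map_mul, map_constSection, constSection_pt, mul_inv_rev]
      simpa only [e] using hr ((G.obj.map s.op).hom g)⁻¹
    · exact CRing.eq_of_isEmpty _ _
    · rw [Finset.sum_eq_single k]
      · rw [← hk, groupRingProj_single_of_mem, groupRingMap_single, groupRing.of_mul_single, hk,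
          ← mul_assoc, ← constSection_mul, inv_mul_cancel, constSection, map_one, one_mul]
      · intro l _ hlk
        rw [groupRingProj_single_of_nowhereIn hi ho (hl l hlk), map_zero, mul_zero]
      · simp

theorem groupRingProj_of_constSection (S : Stonean.{u}) (k l : Fin n) :
    groupRingProj R hi ho S (groupRing.of R (constSection S (r l)) *
      groupRing.of R (constSection S (r k)⁻¹)) = if l = k then 1 else 0 := by
  rw [← groupRing.of_mul, ← constSection_mul]
  split_ifs with h
  · subst h
    rw [mul_inv_cancel, ← groupRing.of_one, constSection, map_one,
      ← map_one (i.hom.app (op S)).hom]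
    exact groupRingProj_single_of_mem hi ho 1 1
  · refine groupRingProj_single_of_nowhereIn hi ho (fun s hs => h ?_) 1
    rw [map_constSection, constSection_pt] at hs
    -- Both `l` and `k` would index the coset of `r l`.
    exact (hr (r l)).unique (by simp) hs

include hi ho in
-- The coordinates of `b` are `π(b [r_k⁻¹])`. Left linearity of `π` and the orthogonality relations
-- recover the coefficients of a combination of the `[r_k]`.
theorem bijective_sum_map_mul_of (S : Stonean.{u}) : Function.Bijective
    (fun x : Fin n → (groupRing R H).obj.obj (op S) =>
      ∑ k, ((groupRingMap R i).hom.app (op S)).hom (x k) *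
        groupRing.of R (constSection S (r k))) := by
  refine Function.bijective_iff_has_inverse.2 ⟨fun b k =>
    groupRingProj R hi ho S (b * groupRing.of R (constSection S (r k)⁻¹)), fun x => ?_, fun b =>
      sum_map_groupRingProj_mul hr hi ho S b⟩
  funext k
  simp only [Finset.sum_mul, map_sum, mul_assoc, groupRingProj_map_mul,
    groupRingProj_of_constSection hr, mul_ite, mul_one, mul_zero]
  simp

end Representatives

theorem exists_representatives {G H : CGrp.{u}} (i : H ⟶ G)
    [Finite (G.obj.obj (op pt.{u}) ⧸ subgroupAt i pt.{u})] :
    ∃ (n : ℕ) (r : Fin n → G.obj.obj (op pt.{u})),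
      ∀ γ : G.obj.obj (op pt.{u}), ∃! k, γ * (r k)⁻¹ ∈ subgroupAt i pt.{u} := by
  obtain ⟨n, ⟨e⟩⟩ := Finite.exists_equiv_fin (G.obj.obj (op pt.{u}) ⧸ subgroupAt i pt.{u})
  -- The quotient consists of left cosets, so representatives are inverted to obtain right cosets.
  refine ⟨n, fun k => (e.symm k).out⁻¹, fun γ => ?_⟩
  have key (k : Fin n) : γ * ((e.symm k).out⁻¹)⁻¹ ∈ subgroupAt i pt.{u} ↔
      e (QuotientGroup.mk γ⁻¹) = k := by
    rw [← Equiv.eq_symm_apply, ← QuotientGroup.out_eq' (e.symm k), QuotientGroup.eq]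
    simp
  simp only [key]
  exact ⟨_, rfl, fun _ h => h.symm⟩

/-! ### Morphisms out of a sheafified module -/

section ModuleSheafification

variable {B : CRing.{u}} {P : PresheafOfModules.{u + 1} B.opp.obj} {N : CMod B}

/-- The morphism of presheaves of abelian groups underlying a morphism from the sheafification of
a presheaf of modules. -/
def presheafHom (f : (PresheafOfModules.sheafification (𝟙 B.opp.obj)).obj P ⟶ N) :
    sheafify site P.presheaf ⟶ N.val.presheaf :=
  (PresheafOfModules.toPresheaf _).map f.val

/-- The morphism from the sheafification induced by a morphism of presheaves of modules. -/
def sheafificationDesc (θ : P ⟶ N.val) :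
    (PresheafOfModules.sheafification (𝟙 B.opp.obj)).obj P ⟶ N :=
  (PresheafOfModules.sheafificationHomEquiv (𝟙 B.opp.obj)).symm
    -- The adjunction has as target the restriction of scalars of `N` along the identity, so `θ` is
    -- repackaged with the same additive maps.
    (PresheafOfModules.homMk ((PresheafOfModules.toPresheaf _).map θ)
      fun S b x => (θ.app S).hom.map_smul b x)

/-- The morphism of presheaves of abelian groups underlying a morphism of presheaves of modules. -/
def abHom {Q : PresheafOfModules.{u + 1} B.opp.obj} (θ : P ⟶ Q) : P.presheaf ⟶ Q.presheaf :=
  (PresheafOfModules.toPresheaf _).map θ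

theorem toSheafify_presheafHom_desc (θ : P ⟶ N.val) :
    toSheafify site P.presheaf ≫ presheafHom (sheafificationDesc θ) = abHom θ := by
  have h := PresheafOfModules.toPresheaf_map_sheafificationHomEquiv_def (𝟙 B.opp.obj)
    (sheafificationDesc θ)
  rw [sheafificationDesc, Equiv.apply_symm_apply] at h
  refine NatTrans.ext (funext fun S => AddCommGrpCat.hom_ext (AddMonoidHom.ext fun x => ?_))
  exact (congrArg (fun k : P.presheaf ⟶ N.val.presheaf => (k.app S).hom x) h).symm

/-- A presheaf isomorphic to a sheaf is a sheaf, so the sheafification unit is invertible, and hence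
so is the induced morphism on underlying abelian sheaves. The forgetful functor reflects
isomorphisms. -/
theorem isIso_sheafificationDesc (θ : P ⟶ N.val)
    (hθ : ∀ S, Function.Bijective (θ.app S).hom) : IsIso (sheafificationDesc θ) := by
  have h (S : Stonean.{u}ᵒᵖ) : IsIso ((abHom θ).app S) :=
    (ConcreteCategory.isIso_iff_bijective _).2 (hθ S)
  have : IsIso (abHom θ) := NatIso.isIso_of_isIso_app _
  have : IsIso (toSheafify site P.presheaf) :=
    isIso_toSheafify _ ((Presheaf.isSheaf_of_iso_iff (asIso (abHom θ))).2 N.isSheaf)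
  have : IsIso (presheafHom (sheafificationDesc θ)) := by
    have : IsIso (toSheafify site P.presheaf ≫ presheafHom (sheafificationDesc θ)) := by
      rw [toSheafify_presheafHom_desc]
      infer_instance
    exact IsIso.of_isIso_comp_left (toSheafify site P.presheaf) _
  have : IsIso ((SheafOfModules.toSheaf _).map (sheafificationDesc θ)) := by
    rw [← isIso_iff_of_reflects_iso _ (sheafToPresheaf _ _)]
    exact this
  exact isIso_of_reflects_iso _ (SheafOfModules.toSheaf _)

end ModuleSheafification

/-! ### Sections and morphisms of `M ⊗_A B` -/

section ExtendApi

variable {A B : CRing.{u}} (φ : A ⟶ B)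

theorem extend.res_tmul {M : CMod A} {S T : Stonean.{u}} (f : T ⟶ S) (m : M.val.obj (op S))
    (b : B.obj.obj (op S)) :
    CMod.res ((extend φ).obj M) f.op (extend.tmul φ m b) =
      extend.tmul φ (M.res f.op m) ((B.obj.map f.op).hom b) :=
  congrArg (fun k => k.hom (TensorAlong.tmul (φ.hom.app (op S)).hom m b))
    ((toSheafify site (tensorPresheaf φ M).presheaf).naturality f.op).symm

theorem extend.app_map_tmul {M N : CMod A} (q : M ⟶ N) {S : Stonean.{u}} (m : M.val.obj (op S))
    (b : B.obj.obj (op S)) :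
    CMod.app ((extend φ).map q) (op S) (extend.tmul φ m b) =
      extend.tmul φ (CMod.app q (op S) m) b :=
  (congrArg (fun k : tensorAb φ M ⟶ sheafify site (tensorAb φ N) =>
    (k.app (op S)).hom (TensorAlong.tmul (φ.hom.app (op S)).hom m b))
    (toSheafify_naturality site ((PresheafOfModules.toPresheaf _).map
      (tensorPresheafMap φ q)))).symm

theorem extend.smul_tmul {M : CMod A} {S : Stonean.{u}} (m : M.val.obj (op S))
    (b c : B.obj.obj (op S)) :
    extend.tmul φ m (b * c) = (MulOpposite.op c : (B.obj.obj (op S) : Type (u + 1))ᵐᵒᵖ) •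
      (extend.tmul φ m b : ((extend φ).obj M).val.obj (op S)) :=
  -- The identity corresponds under the adjunction to the unit, which in this form is visibly
  -- `B`-linear.
  ((PresheafOfModules.sheafificationHomEquiv (𝟙 B.opp.obj)
    (𝟙 ((PresheafOfModules.sheafification (𝟙 B.opp.obj)).obj (tensorPresheaf φ M)))).app
      (op S)).hom.map_smul (MulOpposite.op c : B.opp.obj.obj (op S))
        (TensorAlong.tmul (φ.hom.app (op S)).hom m b)

theorem extend.hom_ext {M : CMod A} {N : CMod B} {p q : (extend φ).obj M ⟶ N}
    (h : ∀ (S : Stonean.{u}) (m : M.val.obj (op S)) (b : B.obj.obj (op S)),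
      CMod.app p (op S) (extend.tmul φ m b) = CMod.app q (op S) (extend.tmul φ m b)) : p = q := by
  refine (PresheafOfModules.sheafificationHomEquiv (𝟙 B.opp.obj)).injective ?_
  refine (PresheafOfModules.toPresheaf _).map_injective ?_
  refine NatTrans.ext (funext fun S => AddCommGrpCat.hom_ext (AddMonoidHom.ext fun x => ?_))
  induction x using TensorAlong.induction with
  | zero => exact (map_zero _).trans (map_zero _).symm
  | add x y hx hy => exact (map_add _ _ _).trans ((congrArg₂ _ hx hy).trans (map_add _ _ _).symm)
  | tmul m b => exact h S.unop m b

variable {φ}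

/-- The morphism `M ⊗_A B → N` induced by a morphism from the presheaf tensor product. -/
def extend.desc {M : CMod A} {N : CMod B} (θ : tensorPresheaf φ M ⟶ N.val) :
    (extend φ).obj M ⟶ N :=
  sheafificationDesc θ

theorem extend.app_desc_tmul {M : CMod A} {N : CMod B} (θ : tensorPresheaf φ M ⟶ N.val)
    {S : Stonean.{u}} (m : M.val.obj (op S)) (b : B.obj.obj (op S)) :
    CMod.app (extend.desc θ) (op S) (extend.tmul φ m b) =
      (θ.app (op S)).hom (TensorAlong.tmul (φ.hom.app (op S)).hom m b) :=
  congrArg (fun k : tensorAb φ M ⟶ N.val.presheaf =>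
    (k.app (op S)).hom (TensorAlong.tmul (φ.hom.app (op S)).hom m b))
    (toSheafify_presheafHom_desc θ)

end ExtendApi

/-! ### Balanced maps on the pointwise tensor product -/

section TensorLift

variable {A B : Type*} [Ring A] [Ring B] {φ : A →+* B}
variable {M : Type*} [AddCommGroup M] [Module Aᵐᵒᵖ M]
variable {P : Type*} [AddCommGroup P] [Module Bᵐᵒᵖ P]

/-- The linear map `M ⊗_A B → P` given by a balanced biadditive map. -/
def TensorAlong.lift (F : B →+ M →+ P)
    (hF : ∀ b c m, F (b * c) m = MulOpposite.op c • F b m)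
    (hF' : ∀ a b m, F (φ a * b) m = F b (MulOpposite.op a • m)) :
    TensorAlong φ M →ₗ[Bᵐᵒᵖ] P :=
  Submodule.liftQ _
    { toFun := TensorProduct.liftAddHom F
        fun z b m => by rw [map_zsmul, map_zsmul, AddMonoidHom.zsmul_apply]
      map_add' := map_add _
      map_smul' := fun c t => by
        induction t with
        | zero => simp
        | add s t hs ht => rw [smul_add, map_add, hs, ht, map_add, smul_add]
        | tmul b m => exact hF b c.unop m } <| by
    refine Submodule.span_le.2 ?_
    rintro _ ⟨a, b, m, rfl⟩
    rw [SetLike.mem_coe, LinearMap.mem_ker, map_sub, sub_eq_zero]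
    exact hF' a b m

variable (φ)

theorem TensorAlong.tmul_add_left (m m' : M) (b : B) :
    TensorAlong.tmul φ (m + m') b = TensorAlong.tmul φ m b + TensorAlong.tmul φ m' b := by
  rw [TensorAlong.tmul, TensorProduct.tmul_add, map_add]
  rfl

theorem TensorAlong.tmul_sum (m : M) {ι : Type*} (s : Finset ι) (b : ι → B) :
    TensorAlong.tmul φ m (∑ k ∈ s, b k) = ∑ k ∈ s, TensorAlong.tmul φ m (b k) := by
  rw [TensorAlong.tmul, TensorProduct.sum_tmul, map_sum]
  rfl

end TensorLift

/-! ### Pointwise Frobenius isomorphism -/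

section Frobenius

variable {A B : CRing.{u}} (φ : A ⟶ B)

/-- A homomorphism `B → A` of `A`-bimodules, for a homomorphism `A → B` of condensed rings. -/
structure BimoduleRetraction where
  /-- The map on sections. -/
  app : ∀ S : Stonean.{u}, B.obj.obj (op S) →+ A.obj.obj (op S)
  map_app : ∀ {S T : Stonean.{u}} (f : T ⟶ S) (b : B.obj.obj (op S)),
    (A.obj.map f.op).hom (app S b) = app T ((B.obj.map f.op).hom b)
  app_mul_map : ∀ (S : Stonean.{u}) (b : B.obj.obj (op S)) (a : A.obj.obj (op S)),
    app S (b * (φ.hom.app (op S)).hom a) = app S b * a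
  app_map_mul : ∀ (S : Stonean.{u}) (b : B.obj.obj (op S)) (a : A.obj.obj (op S)),
    app S ((φ.hom.app (op S)).hom a * b) = a * app S b

variable {φ}

theorem coextendSections.ext {M : CMod A} {S : Stonean.{u}}
    {c d : coextendSections φ M S} (h : ∀ (T : Stonean.{u}) (f : T ⟶ S) (x : B.obj.obj (op T)),
      c.1 T f x = d.1 T f x) : c = d :=
  Subtype.ext (funext fun T => funext fun f => AddMonoidHom.ext (h T f))

variable (π : BimoduleRetraction φ) (M : CMod A)

/-- The additive map `x ↦ m π(b x)`. -/
def retractionHom {T : Stonean.{u}} (m : M.val.obj (op T)) (b : B.obj.obj (op T)) :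
    B.obj.obj (op T) →+ M.val.obj (op T) :=
  AddMonoidHom.mk' (fun x => MulOpposite.op (π.app T (b * x)) • m) fun x y => by
    rw [mul_add, map_add, MulOpposite.op_add, add_smul]

theorem retractionHom_apply {T : Stonean.{u}} (m : M.val.obj (op T)) (b x : B.obj.obj (op T)) :
    retractionHom π M m b x = MulOpposite.op (π.app T (b * x)) • m := rfl

/-- The section `x ↦ m π(b x)` of `Hom_A(B, M)`. -/
def retractionSection {S : Stonean.{u}} (m : M.val.obj (op S)) (b : B.obj.obj (op S)) :
    coextendSections φ M S :=
  ⟨fun T f => retractionHom π M (M.res f.op m) ((B.obj.map f.op).hom b),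
    fun T f x a => by
      rw [retractionHom_apply, retractionHom_apply, ← mul_assoc, π.app_mul_map,
        MulOpposite.op_mul, mul_smul],
    fun T U f g x => by
      rw [retractionHom_apply, retractionHom_apply, CMod.res_smul, π.map_app, RingHom.map_mul,
        CRing.map_comp_hom, op_comp, CMod.res_comp]⟩

theorem retractionSection_apply {S T : Stonean.{u}} (m : M.val.obj (op S))
    (b : B.obj.obj (op S)) (f : T ⟶ S) (x : B.obj.obj (op T)) :
    (retractionSection π M m b).1 T f x =
      MulOpposite.op (π.app T ((B.obj.map f.op).hom b * x)) • M.res f.op m := rfl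

/-- The biadditive map `(b, m) ↦ (x ↦ m π(b x))`. -/
def retractionPairing (S : Stonean.{u}) :
    B.obj.obj (op S) →+ M.val.obj (op S) →+ coextendSections φ M S :=
  AddMonoidHom.mk' (fun b => AddMonoidHom.mk' (fun m => retractionSection π M m b)
    fun m m' => coextendSections.ext fun T f x => by
      change _ = (retractionSection π M m b).1 T f x + (retractionSection π M m' b).1 T f x
      rw [retractionSection_apply, map_add, smul_add]
      rfl)
    fun b b' => AddMonoidHom.ext fun m => coextendSections.ext fun T f x => by
      change (retractionSection π M m (b + b')).1 T f x =
        (retractionSection π M m b).1 T f x + (retractionSection π M m b').1 T f x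
      rw [retractionSection_apply, map_add, add_mul, map_add, MulOpposite.op_add, add_smul]
      rfl

/-- The map `M(S) ⊗_{A(S)} B(S) → Hom_A(B, M)(S)`, `m ⊗ b ↦ (x ↦ m π(b x))`. -/
def tensorToCoextend (S : Stonean.{u}) :
    TensorAlong (φ.hom.app (op S)).hom (M.val.obj (op S))
      →ₗ[(B.obj.obj (op S) : Type (u + 1))ᵐᵒᵖ] coextendSections φ M S :=
  TensorAlong.lift (retractionPairing π M S)
    (fun b c m => coextendSections.ext fun T f x => by
      change (retractionSection π M m (b * c)).1 T f x =
        (retractionSection π M m b).1 T f ((B.obj.map f.op).hom c * x)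
      rw [retractionSection_apply, retractionSection_apply, RingHom.map_mul, mul_assoc])
    (fun a b m => coextendSections.ext fun T f x => by
      change (retractionSection π M m _).1 T f x = (retractionSection π M _ b).1 T f x
      rw [retractionSection_apply, retractionSection_apply, RingHom.map_mul, hom_naturality,
        mul_assoc, π.app_map_mul, MulOpposite.op_mul, mul_smul, CMod.res_smul])

theorem tensorToCoextend_tmul (S : Stonean.{u}) (m : M.val.obj (op S)) (b : B.obj.obj (op S)) :
    tensorToCoextend π M S (TensorAlong.tmul (φ.hom.app (op S)).hom m b) =
      retractionSection π M m b := rfl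

/-- The morphism of presheaves of modules `m ⊗ b ↦ (x ↦ m π(b x))`. -/
def tensorPresheafToCoextend : tensorPresheaf φ M ⟶ coextendPresheaf φ M :=
  PresheafOfModules.homMk
    { app := fun S => AddCommGrpCat.ofHom (tensorToCoextend π M S.unop).toAddMonoidHom
      naturality := fun S T f => by
        ext x
        change tensorToCoextend π M T.unop (tensorRes φ M f x) =
          coextendSections.res φ f.unop (tensorToCoextend π M S.unop x)
        induction x using TensorAlong.induction with
        | zero => simp only [map_zero]
        | add x y hx hy => simp only [map_add, hx, hy]
        | tmul m b =>
          refine coextendSections.ext fun U g x => ?_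
          change (retractionSection π M (M.res f m) ((B.obj.map f).hom b)).1 U g x =
            (retractionSection π M m b).1 U (g ≫ f.unop) x
          rw [retractionSection_apply, retractionSection_apply, CRing.map_comp_hom, op_comp,
            CMod.res_comp]
          rfl }
    fun S b x => (tensorToCoextend π M S.unop).map_smul b x

theorem coextendSections.apply_comp {S T : Stonean.{u}} (c : coextendSections φ M S)
    (f : T ⟶ S) (x : B.obj.obj (op T)) :
    c.1 T f x = (coextendSections.res φ f c).1 T (𝟙 T) x := by
  change _ = c.1 T (𝟙 T ≫ f) x
  rw [Category.id_comp]

/-- The inverse is `c ↦ ∑ c(l_k) ⊗ r_k`. One composite is `∑ m π(b l_k) ⊗ r_k = m ⊗ ∑ π(b l_k) r_k =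
m ⊗ b`, the other `∑ c(l_k) π(r_k x) = c(∑ l_k π(r_k x)) = c(x)`. The second identity is required
over every `T → S`, because `c` is evaluated there. -/
theorem bijective_tensorToCoextend {S : Stonean.{u}} {ι : Type*} [Fintype ι]
    (l r : ι → B.obj.obj (op S))
    (hl : ∀ b, ∑ k, (φ.hom.app (op S)).hom (π.app S (b * l k)) * r k = b)
    (hr : ∀ (T : Stonean.{u}) (f : T ⟶ S) (b : B.obj.obj (op T)),
      ∑ k, (B.obj.map f.op).hom (l k) *
        (φ.hom.app (op T)).hom (π.app T ((B.obj.map f.op).hom (r k) * b)) = b) :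
    Function.Bijective (tensorToCoextend π M S) := by
  refine Function.bijective_iff_has_inverse.2 ⟨fun c => ∑ k, TensorAlong.tmul _
    (c.1 S (𝟙 S) (l k)) (r k), fun x => ?_, fun c => coextendSections.ext fun T f x => ?_⟩
  · induction x using TensorAlong.induction with
    | zero =>
      rw [map_zero]
      refine Finset.sum_eq_zero fun k _ => ?_
      exact (congrArg _ (TensorProduct.tmul_zero _ _)).trans (map_zero _)
    | add x y hx hy =>
      rw [map_add]
      refine Eq.trans ?_ (congrArg₂ _ hx hy)
      rw [← Finset.sum_add_distrib]
      exact Finset.sum_congr rfl fun k _ => TensorAlong.tmul_add_left _ _ _ _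
    | tmul m b =>
      simp only [tensorToCoextend_tmul, retractionSection_apply]
      conv_rhs => rw [← hl b, TensorAlong.tmul_sum]
      refine Finset.sum_congr rfl fun k _ => ?_
      rw [TensorAlong.tmul_mul]
      congr 2
      · simp
      · exact M.res_id _ m
  · simp only [map_sum, tensorToCoextend_tmul]
    have e (d : ι → coextendSections φ M S) : (∑ k, d k : coextendSections φ M S).1 T f x =
        ∑ k, (d k).1 T f x := by
      rw [AddSubgroup.val_finsetSum, Finset.sum_apply, Finset.sum_apply,
        AddMonoidHom.finsetSum_apply]
    rw [e]
    conv_rhs => rw [← hr T f x, map_sum]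
    refine Finset.sum_congr rfl fun k _ => ?_
    rw [c.2.1, retractionSection_apply, ← c.2.2, Category.comp_id]

end Frobenius

/-! ### The natural isomorphism and its characterization -/

section FrobeniusIso

variable {A B : CRing.{u}} {φ : A ⟶ B} (π : BimoduleRetraction φ)

/-- The morphism `M ⊗_A B → Hom_A(B, M)`, `m ⊗ b ↦ (x ↦ m π(b x))`. -/
def extendToCoextend (M : CMod A) : (extend φ).obj M ⟶ (coextend φ).obj M :=
  extend.desc (tensorPresheafToCoextend π M)

theorem extendToCoextend_tmul (M : CMod A) {S : Stonean.{u}} (m : M.val.obj (op S))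
    (b : B.obj.obj (op S)) :
    CMod.app (extendToCoextend π M) (op S) (extend.tmul φ m b) = retractionSection π M m b :=
  extend.app_desc_tmul (N := (coextend φ).obj M) (tensorPresheafToCoextend π M) m b

/-- The natural isomorphism `M ⊗_A B ≅ Hom_A(B, M)` given by a Frobenius extension. -/
def extendIsoCoextend
    (h : ∀ (M : CMod A) (S : Stonean.{u}), Function.Bijective (tensorToCoextend π M S)) :
    extend φ ≅ coextend φ :=
  NatIso.ofComponents
    (fun M =>
      have : IsIso (extendToCoextend π M) :=
        isIso_sheafificationDesc (N := (coextend φ).obj M) (tensorPresheafToCoextend π M)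
          fun S => h M S.unop
      asIso (extendToCoextend π M))
    fun {M N} q => extend.hom_ext φ fun S m b => by
      change CMod.app (extendToCoextend π N) (op S)
          (CMod.app ((extend φ).map q) (op S) (extend.tmul φ m b)) =
        CMod.app ((coextend φ).map q) (op S)
          (CMod.app (extendToCoextend π M) (op S) (extend.tmul φ m b))
      rw [extend.app_map_tmul, extendToCoextend_tmul, extendToCoextend_tmul]
      refine coextendSections.ext fun T f x => ?_
      change (retractionSection π N (CMod.app q (op S) m) b).1 T f x =
        CMod.app q (op T) ((retractionSection π M m b).1 T f x)
      rw [retractionSection_apply, retractionSection_apply, CMod.app_smul, CMod.app_res]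

theorem eval_extendIsoCoextend
    (h : ∀ (M : CMod A) (S : Stonean.{u}), Function.Bijective (tensorToCoextend π M S))
    (M : CMod A) {S : Stonean.{u}} (m : M.val.obj (op S)) (x : B.obj.obj (op S)) :
    coextend.eval φ (CMod.app ((extendIsoCoextend π h).hom.app M) (op S) (extend.tmul φ m 1)) x =
      MulOpposite.op (π.app S x) • m := by
  have e : CMod.app ((extendIsoCoextend π h).hom.app M) (op S) (extend.tmul φ m 1) =
    retractionSection π M m 1 := extendToCoextend_tmul π M m 1
  rw [e]
  change (retractionSection π M m 1).1 S (𝟙 S) x = _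
  rw [retractionSection_apply, map_one, one_mul, op_id, CMod.res_id]

theorem extend.res_app_tmul_one {M : CMod A} {N : CMod B} (p : (extend φ).obj M ⟶ N)
    {S T : Stonean.{u}} (f : T ⟶ S) (m : M.val.obj (op S)) :
    N.res f.op (CMod.app p (op S) (extend.tmul φ m 1)) =
      CMod.app p (op T) (extend.tmul φ (M.res f.op m) 1) := by
  refine (CMod.app_res p f.op _).symm.trans ?_
  rw [extend.res_tmul, map_one]

theorem coextend.res_eval {M : CMod A} {S T : Stonean.{u}}
    (c : ((coextend φ).obj M).val.obj (op S)) (f : T ⟶ S) (x : B.obj.obj (op S)) :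
    M.res f.op (coextend.eval φ c x) =
      coextend.eval φ (CMod.res ((coextend φ).obj M) f.op c) ((B.obj.map f.op).hom x) := by
  refine ((c : coextendSections φ M S).2.2 S T (𝟙 S) f x).symm.trans ?_
  change (c : coextendSections φ M S).1 T (f ≫ 𝟙 S) _ =
    (c : coextendSections φ M S).1 T (𝟙 T ≫ f) _
  rw [Category.comp_id, Category.id_comp]

theorem coextend.res_eval_app {M N : CMod A} (p : (extend φ).obj M ⟶ (coextend φ).obj N)
    {S T : Stonean.{u}} (f : T ⟶ S) (m : M.val.obj (op S)) (x : B.obj.obj (op S)) :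
    N.res f.op (coextend.eval φ (CMod.app p (op S) (extend.tmul φ m 1)) x) =
      coextend.eval φ (CMod.app p (op T) (extend.tmul φ (M.res f.op m) 1))
        ((B.obj.map f.op).hom x) := by
  rw [coextend.res_eval, extend.res_app_tmul_one]

theorem coextend.eval_add {M : CMod A} {S : Stonean.{u}} (c : ((coextend φ).obj M).val.obj (op S))
    (x y : B.obj.obj (op S)) :
    coextend.eval φ c (x + y) = coextend.eval φ c x + coextend.eval φ c y :=
  map_add ((c : coextendSections φ M S).1 S (𝟙 S)) x y

theorem coextend.eval_mul_map {M : CMod A} {S : Stonean.{u}}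
    (c : ((coextend φ).obj M).val.obj (op S)) (x : B.obj.obj (op S)) (a : A.obj.obj (op S)) :
    coextend.eval φ c (x * (φ.hom.app (op S)).hom a) = MulOpposite.op a • coextend.eval φ c x :=
  (c : coextendSections φ M S).2.1 S (𝟙 S) x a

/-- Since `m ⊗ b = (m ⊗ 1) b`, it suffices to compare the images of `m ⊗ 1`. The component at `f : T
→ S` of such an image is the evaluation over `T` of the image of `m|_T ⊗ 1`. -/
theorem extend.hom_ext_coextend {M N : CMod A} {p q : (extend φ).obj M ⟶ (coextend φ).obj N}
    (h : ∀ (S : Stonean.{u}) (m : M.val.obj (op S)) (x : B.obj.obj (op S)),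
      coextend.eval φ (CMod.app p (op S) (extend.tmul φ m 1)) x =
        coextend.eval φ (CMod.app q (op S) (extend.tmul φ m 1)) x) : p = q := by
  refine extend.hom_ext φ fun S m b => ?_
  have key : CMod.app p (op S) (extend.tmul φ m 1) = CMod.app q (op S) (extend.tmul φ m 1) := by
    refine coextendSections.ext fun T f x => ?_
    refine (coextendSections.apply_comp _ _ f x).trans
      (Eq.trans ?_ (coextendSections.apply_comp _ _ f x).symm)
    refine Eq.trans ?_ ((h T (M.res f.op m) x).trans ?_)
    · rw [← extend.res_app_tmul_one]
      rfl
    · rw [← extend.res_app_tmul_one]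
      rfl
  rw [← one_mul b, extend.smul_tmul, CMod.app_smul, CMod.app_smul, key]

end FrobeniusIso

/-! ### Application to group rings -/

section Main

variable (R : CRing.{u}) {G H : CGrp.{u}} {i : H ⟶ G}

/-- The projection of `R[G]` onto `R[H]`, as a homomorphism of bimodules. -/
def groupRingRetraction (hi : IsSubgroup i) (ho : IsOpenSubgroup i) :
    BimoduleRetraction (groupRingMap R i) where
  app := groupRingProj R hi ho
  map_app := map_groupRingProj hi ho
  app_mul_map := groupRingProj_mul_map hi ho
  app_map_mul := groupRingProj_map_mul hi ho

theorem bijective_tensorToCoextend_groupRing (hi : IsSubgroup i) (hfin : HasFiniteIndex i)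
    (M : CMod (groupRing R H)) (S : Stonean.{u}) :
    Function.Bijective (tensorToCoextend (groupRingRetraction R hi hfin.1) M S) := by
  have := hfin.2
  obtain ⟨n, r, hr⟩ := exists_representatives i
  -- The dual bases consist of constant sections, so the second identity is stable under
  -- restriction.
  refine bijective_tensorToCoextend _ M (fun k => groupRing.of R (constSection S (r k)⁻¹))
    (fun k => groupRing.of R (constSection S (r k)))
    (sum_map_groupRingProj_mul hr hi hfin.1 S) fun T f b => ?_
  simp only [groupRing.map_of, map_constSection]
  exact sum_mul_map_groupRingProj hr hi hfin.1 T b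

theorem groupRing.hom_ext_of (ho : IsOpenSubgroup i) {M N : CMod (groupRing R H)}
    {p q : (extend (groupRingMap R i)).obj M ⟶ (coextend (groupRingMap R i)).obj N}
    (h : ∀ (S : Stonean.{u}) (m : M.val.obj (op S)) (g : G.obj.obj (op S)),
      g ∈ subgroupAt i S ∨ NowhereIn i g →
      coextend.eval (groupRingMap R i) (CMod.app p (op S)
        (extend.tmul (groupRingMap R i) m 1)) (groupRing.of R g) =
      coextend.eval (groupRingMap R i) (CMod.app q (op S)
        (extend.tmul (groupRingMap R i) m 1)) (groupRing.of R g)) : p = q := by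
  refine extend.hom_ext_coextend fun S m x => ?_
  revert m
  refine groupRing.induction_mem i ho (p := fun S x => ∀ m : M.val.obj (op S),
      coextend.eval (groupRingMap R i) (CMod.app p (op S)
        (extend.tmul (groupRingMap R i) m 1)) x =
      coextend.eval (groupRingMap R i) (CMod.app q (op S)
        (extend.tmul (groupRingMap R i) m 1)) x) ?_ ?_ ?_ S x
  · intro S x P hP hx m
    refine CMod.ext_of_cover hP fun T f hf => ?_
    rw [coextend.res_eval_app, coextend.res_eval_app, hx T f hf]
  · intro S x y hx hy m
    rw [coextend.eval_add, coextend.eval_add, hx, hy]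
  · intro S g a hg m
    -- Coefficients commute with `[g]`, so they can be moved to the right and removed by
    -- `R[H]`-linearity.
    have e : groupRing.single R g a = groupRing.of R g *
        ((groupRingMap R i).hom.app (op S)).hom (groupRing.single R 1 a) := by
      rw [groupRingMap_single, groupRing.of_mul_single, map_one, mul_one]
    rw [e, coextend.eval_mul_map, coextend.eval_mul_map, h S m g hg]

end Main

end

end Cond

theorem mainTheorem5 (R : Cond.CRing.{u}) (G H : Cond.CGrp.{u}) (i : H ⟶ G)
    (hi : Cond.IsSubgroup i) (hfin : Cond.HasFiniteIndex i) :
    (∀ (n : ℕ) (r : Fin n → G.obj.obj (op Cond.pt.{u})),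
      (∀ γ : G.obj.obj (op Cond.pt.{u}), ∃! k, γ * (r k)⁻¹ ∈ Cond.subgroupAt i Cond.pt.{u}) →
      ∀ S : Stonean.{u}, Function.Bijective
        (fun x : Fin n → (Cond.groupRing R H).obj.obj (op S) =>
          ∑ k, ((Cond.groupRingMap R i).hom.app (op S)).hom (x k) *
            Cond.groupRing.of R (Cond.constSection S (r k)))) ∧
    (∃! e : Cond.ind R i ≅ Cond.coind R i,
      ∀ (M : Cond.CMod (Cond.groupRing R H)) (S : Stonean.{u}) (m : M.val.obj (op S))
        (g : G.obj.obj (op S)),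
        (∀ h : H.obj.obj (op S), (i.hom.app (op S)).hom h = g →
          Cond.coextend.eval (Cond.groupRingMap R i) (Cond.CMod.app (e.hom.app M) (op S)
            (Cond.extend.tmul (Cond.groupRingMap R i) m 1)) (Cond.groupRing.of R g) =
              MulOpposite.op (Cond.groupRing.of R h) • m) ∧
        ((∀ s : Cond.pt.{u} ⟶ S, (G.obj.map s.op).hom g ∉ Cond.subgroupAt i Cond.pt.{u}) →
          Cond.coextend.eval (Cond.groupRingMap R i) (Cond.CMod.app (e.hom.app M) (op S)
            (Cond.extend.tmul (Cond.groupRingMap R i) m 1)) (Cond.groupRing.of R g) = 0)) := by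
  refine ⟨fun n r hr S => Cond.bijective_sum_map_mul_of hr hi hfin.1 S,
    Cond.extendIsoCoextend (Cond.groupRingRetraction R hi hfin.1)
      (Cond.bijective_tensorToCoextend_groupRing R hi hfin), ?_, ?_⟩
  · intro M S m g
    refine ⟨fun h hg => ?_, fun hg => ?_⟩
    · refine (Cond.eval_extendIsoCoextend _ _ M m _).trans ?_
      subst hg
      exact congrArg (fun a => MulOpposite.op a • m)
        (Cond.groupRingProj_single_of_mem hi hfin.1 h 1)
    · refine (Cond.eval_extendIsoCoextend _ _ M m _).trans ?_
      refine (congrArg (fun a => MulOpposite.op a • m)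
        (Cond.groupRingProj_single_of_nowhereIn hi hfin.1 hg 1)).trans ?_
      rw [MulOpposite.op_zero, zero_smul]
  · intro e he
    -- The two clauses prescribe the evaluations at exactly the sections `[g]` that determine a
    -- morphism.
    refine Iso.ext (NatTrans.ext (funext fun M => Cond.groupRing.hom_ext_of R hfin.1 ?_))
    rintro S m g (⟨h, rfl⟩ | hg)
    · refine ((he M S m _).1 h rfl).trans ?_
      refine Eq.symm ((Cond.eval_extendIsoCoextend _ _ M m _).trans ?_)
      exact congrArg (fun a => MulOpposite.op a • m)
        (Cond.groupRingProj_single_of_mem hi hfin.1 h 1)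
    · refine ((he M S m g).2 hg).trans ?_
      refine Eq.symm ((Cond.eval_extendIsoCoextend _ _ M m _).trans ?_)
      refine (congrArg (fun a => MulOpposite.op a • m)
        (Cond.groupRingProj_single_of_nowhereIn hi hfin.1 hg 1)).trans ?_
      rw [MulOpposite.op_zero, zero_smul]
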